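/- Let $d\ge 1$ and $k\ge 1$ be fixed integers, let $f:\mathbb{R}^d\to[0,\infty)$ be a bounded measurable probability density, let $r=r(n)>0$, and for each $n$ let $\rho=\rho(n)=(p_1,p_2,\dots)$ be a vector of probabilities $p_i=p_i(n)\in[0,1]$. Let $X_1,\dots,X_n$ be i.i.d. random points in $\mathbb{R}^d$ with density $f$. The soft random Vietoris–Rips complex $R(n,r,\rho)$ is the random simplicial complex with vertices $X_1,\dots,X_n$ built dimension by dimension as follows: all vertices are kept; for $i\ge 1$, an $i$-simplex $\sigma$ on these vertices is a candidate if $B(X_a,r/2)\cap B(X_b,r/2)\neq\emptyset$ (closed balls) for every pair $X_a,X_b\in\sigma$ and all proper faces of $\sigma$ have been kept; each candidate $i$-simplex is then kept with probability $p_i$, all these choices being independent of each other and of the points. Let $\beta_k(R(n,r,\rho))$ be the dimension of the $k$-th simplicial homology of $R(n,r,\rho)$ with coefficients in a field (any fixed one), and let $\hat T_{k+1}(\rho)$ be the number of connected components of $R(n,r,\rho)$ that are isomorphic, as simplicial complexes, to the boundary of a $(k+1)$-simplex. **Theorem.** Suppose that $(1-p_{k+1})\prod_{i=1}^{k}p_i^{\binom{k+1}{i}}\neq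 0$ for all sufficiently large $n$ and that $$\lim_{n\to\infty}\frac{n r^d}{(1-p_{k+1})\prod_{i=1}^{k}p_i^{\binom{k+1}{i}}}=0 .$$ Then $E\big(\beta_k(R(n,r,\rho))\big)\sim E\big(\hat T_{k+1}(\rho)\big)$, that is, $$\lim_{n\to\infty}\frac{E\big(\beta_k(R(n,r,\rho))\big)}{E\big(\hat T_{k+1}(\rho)\big)}=1 .$$ -/

import Mathlib

open MeasureTheory ProbabilityTheory Filter Topology

noncomputable section

namespace SoftRips

/-! ### Simplicial homology and components of abstract simplicial complexes -/

section Complexes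

variable {V W : Type*}

/-- The faces of `K` with exactly `m` vertices, that is, of dimension `m - 1`.
There are none for `m = 0`, because faces are nonempty. -/
abbrev Face (K : AbstractSimplicialComplex V) (m : ℕ) : Type _ :=
  {σ : Finset V // σ ∈ K ∧ σ.card = m}

/-- The space of simplicial chains on the faces with `m` vertices (`V` being finite), with
coefficients in `F`: the chain `c` stands for the formal sum `∑ σ, c σ • [σ]`. -/
abbrev Chain (F : Type*) [Field F] (K : AbstractSimplicialComplex V) (m : ℕ) : Type _ :=
  Face K m → F

/-- The simplicial boundary map, which sends a face `σ = {v₀ < v₁ < ⋯ < vₘ}` to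
`∑ᵢ (-1)ⁱ [σ \ {vᵢ}]`. So the coefficient of `τ` in `∂ c` is the sum, over all vertices `v ∉ τ`
such that `τ ∪ {v}` is a face, of `(-1)ⁱ c (τ ∪ {v})`, where `i` is the number of vertices
of `τ` that precede `v`. For `m = 0` the target is trivial, so the map is zero. -/
def boundary [Fintype V] [LinearOrder V] (F : Type*) [Field F] (K : AbstractSimplicialComplex V)
    (m : ℕ) : Chain F K (m + 1) →ₗ[F] Chain F K m where
  toFun c τ :=
    ∑ v : V,
      open Classical in
      if h : v ∉ τ.1 ∧ insert v τ.1 ∈ K then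
        (-1 : F) ^ (τ.1.filter (fun u => u < v)).card *
          c ⟨insert v τ.1, h.2, by rw [Finset.card_insert_of_notMem h.1, τ.2.2]⟩
      else 0
  map_add' c c' := by
    funext τ
    simp only [Pi.add_apply, ← Finset.sum_add_distrib]
    refine Finset.sum_congr rfl fun v _ => ?_
    split_ifs
    · ring
    · ring
  map_smul' a c := by
    funext τ
    simp only [Pi.smul_apply, smul_eq_mul, RingHom.id_apply, Finset.mul_sum]
    refine Finset.sum_congr rfl fun v _ => ?_
    split_ifs
    · ring
    · ring

/-- The `k`-th simplicial homology of `K` with coefficients in `F`: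
the `k`-cycles modulo the `k`-boundaries. -/
abbrev Homology [Fintype V] [LinearOrder V] (F : Type*) [Field F]
    (K : AbstractSimplicialComplex V) (k : ℕ) : Type _ :=
  LinearMap.ker (boundary F K k) ⧸
    (LinearMap.range (boundary F K (k + 1))).submoduleOf (LinearMap.ker (boundary F K k))

/-- The `k`-th Betti number of `K` over `F`. -/
def betti [Fintype V] [LinearOrder V] (F : Type*) [Field F] (K : AbstractSimplicialComplex V)
    (k : ℕ) : ℕ :=
  Module.finrank F (Homology F K k)

/-- The `1`-skeleton of `K`, as a graph on its vertices. -/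
def skeletonGraph [DecidableEq V] (K : AbstractSimplicialComplex V) : SimpleGraph V where
  Adj u v := u ≠ v ∧ ({u, v} : Finset V) ∈ K
  symm := ⟨fun u v h => ⟨h.1.symm, by rw [Finset.pair_comm]; exact h.2⟩⟩
  loopless := ⟨fun _ h => h.1 rfl⟩

/-- The subcomplex of `K` induced on a set `S` of vertices. -/
def induced (K : AbstractSimplicialComplex V) (S : Set V) : AbstractSimplicialComplex S where
  faces := {σ | σ.map (Function.Embedding.subtype (· ∈ S)) ∈ K}
  isRelLowerSet_faces := by
    intro σ hσ
    have h := K.isRelLowerSet_faces hσ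
    exact ⟨by simpa using h.1, fun τ hτ hne => h.2 (Finset.map_subset_map.2 hτ) (by simpa using hne)⟩
  singleton_mem v := by
    change Finset.map _ {v} ∈ K
    rw [Finset.map_singleton]
    exact K.singleton_mem _

/-- Isomorphism of abstract simplicial complexes: a bijection between the vertices under which
the faces correspond. -/
def Isomorphic (K : AbstractSimplicialComplex V) (L : AbstractSimplicialComplex W) : Prop :=
  ∃ e : V ≃ W, ∀ σ : Finset V, σ ∈ K ↔ σ.map e.toEmbedding ∈ L

/-- The boundary of the `(k + 1)`-simplex: the vertices are `0, …, k + 1`, and the faces are all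
nonempty proper subsets. -/
def simplexBoundary (k : ℕ) : AbstractSimplicialComplex (Fin (k + 2)) where
  faces := {σ | σ.Nonempty ∧ σ ≠ Finset.univ}
  isRelLowerSet_faces := by
    rintro σ ⟨h₁, h₂⟩
    refine ⟨h₁, fun τ hτ hne => ⟨hne, ?_⟩⟩
    rintro rfl
    exact h₂ (Finset.univ_subset_iff.1 hτ)
  singleton_mem v := by
    refine ⟨Finset.singleton_nonempty v, fun h => ?_⟩
    have := congrArg Finset.card h
    simp at this

/-- The number of connected components of `K` that are isomorphic to the boundary of the
`(k + 1)`-simplex. -/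
def boundaryComponents [DecidableEq V] (K : AbstractSimplicialComplex V) (k : ℕ) : ℕ :=
  Nat.card {c : (skeletonGraph K).ConnectedComponent //
    Isomorphic (induced K c.supp) (simplexBoundary k)}

end Complexes

/-! ### The soft random Vietoris–Rips complex -/

section Random

variable {ι E : Type*}

/-- The Vietoris–Rips complex of the points `x i` with parameter `r`: a nonempty finite set of
indices is a face when the closed balls of radius `r / 2` around any two of its points meet. -/
def vietorisRips [PseudoMetricSpace E] (x : ι → E) (r : ℝ) : AbstractSimplicialComplex ι where
  faces := {σ | σ.Nonempty ∧ ∀ i ∈ σ, ∀ j ∈ σ, i ≠ j →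
    (Metric.closedBall (x i) (r / 2) ∩ Metric.closedBall (x j) (r / 2)).Nonempty}
  isRelLowerSet_faces := by
    rintro σ ⟨h₁, h₂⟩
    exact ⟨h₁, fun τ hτ hne => ⟨hne, fun i hi j hj => h₂ i (hτ hi) j (hτ hj)⟩⟩
  singleton_mem v := by
    refine ⟨Finset.singleton_nonempty v, fun i hi j hj hij => ?_⟩
    rw [Finset.mem_singleton] at hi hj
    exact absurd (hi.trans hj.symm) hij

/-- Thinning of a complex `K` by coins `ξ`, one for each simplex of positive dimension: built up
dimension by dimension, a simplex of `K` whose proper faces have all been kept is kept itself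
exactly when its own coin is `true`. All vertices are kept. -/
def thin (K : AbstractSimplicialComplex ι) (ξ : Finset ι → Bool) :
    AbstractSimplicialComplex ι where
  faces := {σ | σ ∈ K ∧ ∀ τ ⊆ σ, 2 ≤ τ.card → ξ τ = true}
  isRelLowerSet_faces := by
    rintro σ ⟨h₁, h₂⟩
    have h := K.isRelLowerSet_faces h₁
    exact ⟨h.1, fun τ hτ hne => ⟨h.2 hτ hne, fun υ hυ => h₂ υ (hυ.trans hτ)⟩⟩
  singleton_mem v := by
    refine ⟨K.singleton_mem v, fun τ hτ h => ?_⟩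
    have := Finset.card_le_card hτ
    rw [Finset.card_singleton] at this
    omega

/-- The sample space: the positions of `n` points in `ℝᵈ`, and a coin for each set of indices. -/
abbrev Sample (d n : ℕ) : Type :=
  (Fin n → EuclideanSpace ℝ (Fin d)) × (Finset (Fin n) → Bool)

/-- The law of the sample: the `n` points are independent with common density `f`, and
independently of them and of each other the coins of the `i`-dimensional simplices (those with
`i + 1` vertices) are `true` with probability `p i`. -/
def sampleLaw {d : ℕ} (f : EuclideanSpace ℝ (Fin d) → ℝ) (p : ℕ → unitInterval) (n : ℕ) :
    Measure (Sample d n) :=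
  (Measure.pi fun _ : Fin n => volume.withDensity fun x => ENNReal.ofReal (f x)).prod
    (Measure.pi fun τ : Finset (Fin n) => bernoulliMeasure true false (p (τ.card - 1)))

/-- The soft Vietoris–Rips complex `R(n, r, ρ)`, as a function of the sample. -/
def softRips {d n : ℕ} (r : ℝ) (ω : Sample d n) : AbstractSimplicialComplex (Fin n) :=
  thin (vietorisRips ω.1 r) ω.2

end Random

end SoftRips

end

/-! The proof is a deterministic sandwich for the Betti number followed by a comparison of two
expectations.

Deterministic part. Call a vertex set hollow if it spans an isolated copy of the boundary of the `(k
+ 1)`-simplex, and call a `k`-face crowded if its connected neighbourhood has at least two further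
vertices. For every complex and `k ≥ 1`, `#hollow ≤ β_k ≤ #hollow + #crowded`
(`card_hollowSets_le_betti`, `betti_le`). Each hollow set carries its own homology class.
Conversely, a `k`-face that is not crowded lies in a component with at most `k + 2` vertices. There
a cycle has, up to sign, one free coefficient; it is zero if a facet is missing, comes from a
boundary if the component is a full simplex, and survives only on a hollow set. By
`boundaryComponents_eq`, hollow sets are exactly the components being counted.

Probabilistic part. Write `Q` for the product of the `p i ^ (k+1).choose (i+1)`, the price of the
coins of one `k`-simplex. A crowded face needs `k + 3` points joined by `k + 2` short distances, so
the expected number is `O(n^(k+3) r^(d(k+2)) Q)` (`integral_crowdedFaces_le`). A hollow set needs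
only `k + 2` mutually close points, so the expected number is at least of order `n^(k+2) r^(d(k+1))
(1 - p (k+1)) ∏ p i ^ (k+2).choose (i+1)` (`le_integral_hollowSets`). By Pascal's rule the quotient
of the two bounds is a constant times the quantity assumed to tend to zero. -/

noncomputable section

namespace SoftRips

/-! ### Cycles and boundaries as functions on all finite sets -/

section Extend

variable {V F : Type*} [Field F]

/-- Extension of a chain by zero. -/
def extendChain {K : AbstractSimplicialComplex V} {m : ℕ} (c : Chain F K m) (σ : Finset V) : F :=
  open Classical in if h : σ ∈ K ∧ σ.card = m then c ⟨σ, h⟩ else 0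

theorem extendChain_face {K : AbstractSimplicialComplex V} {m : ℕ} (c : Chain F K m)
    (σ : Face K m) : extendChain c σ.1 = c σ := dif_pos σ.2

theorem face_mono {K : AbstractSimplicialComplex V} {σ τ : Finset V} (hσ : σ ∈ K) (h : τ ⊆ σ)
    (hτ : τ.Nonempty) : τ ∈ K := (K.isRelLowerSet_faces hσ).2 h hτ

theorem extendChain_of_notMem {K : AbstractSimplicialComplex V} {m : ℕ} (c : Chain F K m)
    {σ : Finset V} (h : σ ∉ K) : extendChain c σ = 0 := dif_neg fun h' => h h'.1

end Extend

/-! ### Incidence signs and `∂ ∘ ∂ = 0`. -/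

section Algebra

variable {V : Type*} [LinearOrder V] (F : Type*) [Field F]

/-- The incidence sign of `v` relative to `τ`. -/
def incidence (τ : Finset V) (v : V) : F := (-1) ^ (τ.filter (fun u => u < v)).card

variable {F}

theorem incidence_mul_self (τ : Finset V) (v : V) : incidence F τ v * incidence F τ v = 1 := by
  rw [incidence, ← mul_pow]; simp

theorem incidence_ne_zero (τ : Finset V) (v : V) : incidence F τ v ≠ 0 :=
  left_ne_zero_of_mul_eq_one (incidence_mul_self τ v)

theorem incidence_insert_of_lt {τ : Finset V} {v w : V} (h : v < w) (hv : v ∉ τ) :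
    incidence F (insert v τ) w = -incidence F τ w := by
  rw [incidence, incidence, Finset.filter_insert, if_pos h,
    Finset.card_insert_of_notMem (by simp [hv]), pow_succ, mul_neg_one]

theorem incidence_insert_of_gt {τ : Finset V} {v w : V} (h : w < v) :
    incidence F (insert v τ) w = incidence F τ w := by
  rw [incidence, incidence, Finset.filter_insert, if_neg h.le.not_gt]

theorem incidence_insert_antisymm {τ : Finset V} {v w : V} (hvw : v ≠ w) (hv : v ∉ τ)
    (hw : w ∉ τ) :
    incidence F τ v * incidence F (insert v τ) w =
      -(incidence F τ w * incidence F (insert w τ) v) := by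
  rcases lt_or_gt_of_ne hvw with h | h
  · rw [incidence_insert_of_lt h hv, incidence_insert_of_gt h]; ring
  · rw [incidence_insert_of_gt h, incidence_insert_of_lt h hw]; ring

theorem incidence_erase_min' (S : Finset V) (hS : S.Nonempty) :
    incidence F (S.erase (S.min' hS)) (S.min' hS) = 1 := by
  rw [incidence, Finset.filter_eq_empty_iff.2, Finset.card_empty, pow_zero]
  intro u hu
  exact (S.min'_le u (Finset.mem_of_mem_erase hu)).not_gt

variable [Fintype V]

/-- The simplicial boundary of a formal combination of arbitrary finite sets. -/
def formalBoundary (c : Finset V → F) (τ : Finset V) : F :=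
  ∑ v, if v ∉ τ then incidence F τ v * c (insert v τ) else 0

/-- Exchanging the two inserted vertices is a sign-reversing involution on the terms. Working with
all finite sets, not just faces, allows taking the boundary of a simplex that is missing from the
complex. -/
theorem formalBoundary_formalBoundary (c : Finset V → F) (τ : Finset V) :
    formalBoundary (formalBoundary c) τ = 0 := by
  have h : formalBoundary (formalBoundary c) τ = ∑ x : V × V,
      if x.1 ∉ τ ∧ x.2 ∉ insert x.1 τ then
        incidence F τ x.1 * incidence F (insert x.1 τ) x.2 * c (insert x.2 (insert x.1 τ))
      else 0 := by
    rw [Fintype.sum_prod_type]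
    refine Finset.sum_congr rfl fun v _ => ?_
    by_cases hv : v ∈ τ
    · simp [hv]
    · simp only [hv, not_false_eq_true, if_true, true_and, formalBoundary, Finset.mul_sum]
      refine Finset.sum_congr rfl fun w _ => ?_
      split_ifs <;> ring
  rw [h]
  refine Finset.sum_involution (fun x _ => x.swap) ?_ ?_ (fun _ _ => Finset.mem_univ _)
    (fun _ _ => rfl)
  · rintro ⟨v, w⟩ -
    simp only [Prod.swap]
    by_cases hvw : v = w
    · subst hvw; simp
    by_cases hv : v ∈ τ
    · simp [hv]
    by_cases hw : w ∈ τ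
    · simp [hw]
    simp only [Finset.mem_insert, hv, hw, hvw, Ne.symm hvw, or_self, not_false_eq_true, and_self,
      if_true, Finset.insert_comm w v, incidence_insert_antisymm hvw hv hw]
    ring
  · rintro ⟨v, w⟩ - hne heq
    obtain rfl : w = v := congrArg Prod.fst heq
    simp at hne

theorem boundary_apply {K : AbstractSimplicialComplex V} {m : ℕ} (c : Chain F K (m + 1))
    (τ : Face K m) : boundary F K m c τ = formalBoundary (extendChain c) τ.1 := by
  change Finset.sum _ _ = _
  refine Finset.sum_congr rfl fun v _ => ?_
  by_cases hv : v ∈ τ.1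
  · simp [hv]
  · by_cases hK : insert v τ.1 ∈ K
    · have : (insert v τ.1).card = m + 1 := by rw [Finset.card_insert_of_notMem hv, τ.2.2]
      simp [hv, hK, incidence, extendChain, this]
    · simp [hv, hK, incidence, extendChain]

/-- No edge of `K` leaves `S`. -/
def Isolated (K : AbstractSimplicialComplex V) (S : Finset V) : Prop :=
  ∀ a ∈ S, ∀ b ∉ S, ({a, b} : Finset V) ∉ K

end Algebra

/-! ### Cycles near isolated vertex sets. -/

section Betti

variable {V : Type*} [LinearOrder V] {F : Type*} [Field F]

theorem Isolated.mem_of_insert_mem {K : AbstractSimplicialComplex V} {S τ : Finset V}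
    (hS : Isolated K S) (hτ : τ ⊆ S) (hne : τ.Nonempty) {v : V} (hv : insert v τ ∈ K) : v ∈ S := by
  by_contra hvS
  obtain ⟨a, ha⟩ := hne
  refine hS a (hτ ha) v hvS (face_mono hv ?_ ⟨a, by simp⟩)
  intro x hx
  simp only [Finset.mem_insert, Finset.mem_singleton] at hx ⊢
  rcases hx with rfl | rfl
  · exact Or.inr ha
  · exact Or.inl rfl

variable [Fintype V]

/-- If `τ` is not a face, no coface of it is one either. Here `k ≥ 1` matters: for `τ = ∅` the
formal boundary is the augmentation, which need not vanish on unreduced cycles. -/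
theorem formalBoundary_extendChain_of_cycle {K : AbstractSimplicialComplex V} {k : ℕ} (hk : 1 ≤ k)
    {z : Chain F K (k + 1)} (hz : boundary F K k z = 0) {τ : Finset V} (hτ : τ.card = k) :
    formalBoundary (extendChain z) τ = 0 := by
  by_cases h : τ ∈ K
  · rw [← boundary_apply z ⟨τ, h, hτ⟩, hz]; rfl
  · refine Finset.sum_eq_zero fun v _ => ?_
    split_ifs with hv
    · rfl
    · rw [extendChain_of_notMem, mul_zero]
      intro h'
      exact h (face_mono h' (Finset.subset_insert _ _) (Finset.card_pos.1 (by omega)))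

/-- A cycle takes, up to sign, the same value on all facets of an isolated set. -/
theorem cycle_erase_eq {K : AbstractSimplicialComplex V} {k : ℕ} (hk : 1 ≤ k)
    {z : Chain F K (k + 1)} (hz : boundary F K k z = 0) {S : Finset V} (hS : Isolated K S)
    (hc : S.card = k + 2) {v w : V} (hv : v ∈ S) (hw : w ∈ S) :
    incidence F (S.erase v) v * extendChain z (S.erase v) =
      incidence F (S.erase w) w * extendChain z (S.erase w) := by
  by_cases hvw : v = w
  · rw [hvw]
  set τ := (S.erase v).erase w with hτ
  have hwv : w ∈ S.erase v := Finset.mem_erase.2 ⟨Ne.symm hvw, hw⟩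
  have hvw' : v ∈ S.erase w := Finset.mem_erase.2 ⟨hvw, hv⟩
  have hτc : τ.card = k := by
    rw [hτ, Finset.card_erase_of_mem hwv, Finset.card_erase_of_mem hv]; omega
  have e1 : S.erase v = insert w τ := (Finset.insert_erase hwv).symm
  have e2 : S.erase w = insert v τ := by
    rw [hτ, Finset.erase_right_comm, Finset.insert_erase hvw']
  have hvτ : v ∉ τ := by simp [hτ]
  have hwτ : w ∉ τ := by simp [hτ]
  have h0 := formalBoundary_extendChain_of_cycle hk hz hτc
  -- Since `S` is isolated, the only possible cofaces of the codimension-two set `τ` are the two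
  -- facets in question.
  have hsum : formalBoundary (extendChain z) τ =
      incidence F τ v * extendChain z (insert v τ) +
        incidence F τ w * extendChain z (insert w τ) := by
    rw [formalBoundary, ← Finset.sum_subset (Finset.subset_univ {v, w}), Finset.sum_pair hvw,
      if_pos hvτ, if_pos hwτ]
    intro u _ hu
    simp only [Finset.mem_insert, Finset.mem_singleton, not_or] at hu
    split_ifs with huτ
    · rfl
    · rw [extendChain_of_notMem, mul_zero]
      intro h
      have huS := hS.mem_of_insert_mem (τ := τ)
        ((Finset.erase_subset _ _).trans (Finset.erase_subset _ _))
        (Finset.card_pos.1 (by omega)) h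
      exact huτ (Finset.mem_erase.2 ⟨hu.2, Finset.mem_erase.2 ⟨hu.1, huS⟩⟩)
  rw [h0] at hsum
  rw [e1, e2]
  rcases lt_or_gt_of_ne hvw with h | h
  · rw [incidence_insert_of_gt h, incidence_insert_of_lt h hvτ]
    have a := incidence_mul_self (F := F) τ v
    have b := incidence_mul_self (F := F) τ w
    set s := incidence F τ v
    set t := incidence F τ w
    linear_combination (-s * t) * hsum - t * extendChain z (insert v τ) * a -
      s * extendChain z (insert w τ) * b
  · rw [incidence_insert_of_gt h, incidence_insert_of_lt h hwτ]
    have a := incidence_mul_self (F := F) τ v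
    have b := incidence_mul_self (F := F) τ w
    set s := incidence F τ v
    set t := incidence F τ w
    linear_combination (s * t) * hsum + t * extendChain z (insert v τ) * a +
      s * extendChain z (insert w τ) * b

/-- A facet of `σ` has no coface other than `σ`, so the cycle condition at that facet leaves a
single term. -/
theorem cycle_isolated_eq_zero {K : AbstractSimplicialComplex V} {k : ℕ} (hk : 1 ≤ k)
    {z : Chain F K (k + 1)} (hz : boundary F K k z = 0) {σ : Finset V} (hσ : Isolated K σ)
    (hc : σ.card = k + 1) : extendChain z σ = 0 := by
  obtain ⟨v, hv⟩ : σ.Nonempty := Finset.card_pos.1 (by omega)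
  have hτc : (σ.erase v).card = k := by rw [Finset.card_erase_of_mem hv]; omega
  have h0 := formalBoundary_extendChain_of_cycle hk hz hτc
  rw [formalBoundary, Finset.sum_eq_single v, if_pos (Finset.notMem_erase _ _),
    Finset.insert_erase hv] at h0
  · exact (mul_eq_zero.1 h0).resolve_left (incidence_ne_zero _ _)
  · intro u _ huv
    split_ifs with hu
    · rfl
    · rw [extendChain_of_notMem, mul_zero]
      intro h
      have := hσ.mem_of_insert_mem (Finset.erase_subset _ _) (Finset.card_pos.1 (by omega)) h
      exact hu (Finset.mem_erase.2 ⟨huv, this⟩)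
  · simp

open Classical in
/-- The vertex sets of the isolated copies of the boundary of the `(k + 1)`-simplex in `K`. -/
def hollowSets (K : AbstractSimplicialComplex V) (k : ℕ) : Finset (Finset V) :=
  Finset.univ.filter fun S =>
    S.card = k + 2 ∧ Isolated K S ∧ (∀ τ ⊂ S, τ.Nonempty → τ ∈ K) ∧ S ∉ K

open Classical in
/-- The `k`-faces of `K` that extend, along edges of `K`, to connected sets with two more
vertices. -/
def crowdedFaces (K : AbstractSimplicialComplex V) (k : ℕ) : Finset (Finset V) :=
  Finset.univ.filter fun σ =>
    σ ∈ K ∧ σ.card = k + 1 ∧ ∃ u ∉ σ, ∃ v ∉ insert u σ,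
      (∃ a ∈ σ, ({a, u} : Finset V) ∈ K) ∧ ∃ b ∈ insert u σ, ({b, v} : Finset V) ∈ K

theorem mem_hollowSets {K : AbstractSimplicialComplex V} {k : ℕ} {S : Finset V} :
    S ∈ hollowSets K k ↔
      S.card = k + 2 ∧ Isolated K S ∧ (∀ τ ⊂ S, τ.Nonempty → τ ∈ K) ∧ S ∉ K := by
  simp [hollowSets]

theorem mem_crowdedFaces {K : AbstractSimplicialComplex V} {k : ℕ} {σ : Finset V} :
    σ ∈ crowdedFaces K k ↔ σ ∈ K ∧ σ.card = k + 1 ∧ ∃ u ∉ σ, ∃ v ∉ insert u σ,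
      (∃ a ∈ σ, ({a, u} : Finset V) ∈ K) ∧ ∃ b ∈ insert u σ, ({b, v} : Finset V) ∈ K := by
  simp [crowdedFaces]

theorem isolated_or_of_notMem_crowdedFaces {K : AbstractSimplicialComplex V} {k : ℕ}
    {σ : Finset V} (hσ : σ ∈ K) (hc : σ.card = k + 1) (h : σ ∉ crowdedFaces K k) :
    Isolated K σ ∨ ∃ u ∉ σ, Isolated K (insert u σ) := by
  rw [or_iff_not_imp_left]
  intro hi
  simp only [Isolated, not_forall, not_not] at hi
  obtain ⟨a, ha, u, hu, hau⟩ := hi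
  refine ⟨u, hu, fun b hb v hv hbv => h ?_⟩
  exact mem_crowdedFaces.2 ⟨hσ, hc, u, hu, v, hv, ⟨a, ha, hau⟩, b, hb, hbv⟩

/-- A cycle that vanishes on the crowded faces and on one facet of each hollow set is a
boundary. -/
theorem mem_range_boundary {K : AbstractSimplicialComplex V} {k : ℕ} (hk : 1 ≤ k)
    {z : Chain F K (k + 1)} (hz : boundary F K k z = 0)
    (hL : ∀ σ ∈ crowdedFaces K k, extendChain z σ = 0)
    (hT : ∀ S ∈ hollowSets K k, ∀ hS : S.Nonempty, extendChain z (S.erase (S.min' hS)) = 0) :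
    z ∈ LinearMap.range (boundary F K (k + 1)) := by
  classical
  have hne : ∀ S : Face K (k + 2), S.1.Nonempty := fun S => (K.isRelLowerSet_faces S.2.1).1
  -- In the boundary of `S`, the facet opposite the least vertex has sign `+1`, so its coefficient
  -- in `z` is the right weight for `S`. Only isolated simplices are needed.
  refine ⟨fun S => if Isolated K S.1 then extendChain z (S.1.erase (S.1.min' (hne S))) else 0, ?_⟩
  funext σ
  set c : Chain F K (k + 2) := fun S =>
    if Isolated K S.1 then extendChain z (S.1.erase (S.1.min' (hne S))) else 0 with hcdef
  have hσne : σ.1.Nonempty := (K.isRelLowerSet_faces σ.2.1).1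
  have hc0 : ∀ {S : Finset V}, ¬ Isolated K S → extendChain c S = 0 := by
    intro S hS
    by_cases h : S ∈ K ∧ S.card = k + 2
    · rw [extendChain_face c ⟨S, h⟩, hcdef]; exact if_neg hS
    · exact dif_neg h
  rw [boundary_apply, ← extendChain_face z σ]
  -- No isolated set has the form `insert v σ` with `σ` crowded, so the chain contributes nothing
  -- there.
  by_cases hσL : σ.1 ∈ crowdedFaces K k
  · rw [hL _ hσL]
    refine Finset.sum_eq_zero fun v _ => ?_
    split_ifs with hv
    · rfl
    · rw [hc0, mul_zero]
      intro hi
      obtain ⟨-, -, u, hu, w, hw, ⟨a, ha, hau⟩, b, hb, hbw⟩ := mem_crowdedFaces.1 hσL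
      have huv : u = v := by
        by_contra huv
        exact hi a (Finset.mem_insert_of_mem ha) u (by simp [huv, hu]) hau
      subst huv
      exact hi b hb w hw hbw
  rcases isolated_or_of_notMem_crowdedFaces σ.2.1 σ.2.2 hσL with hi | ⟨u, hu, hi⟩
  · rw [cycle_isolated_eq_zero hk hz hi σ.2.2]
    refine Finset.sum_eq_zero fun v _ => ?_
    split_ifs with hv
    · rfl
    · rw [extendChain_of_notMem, mul_zero]
      exact fun h => hv (hi.mem_of_insert_mem subset_rfl hσne h)
  · have hcard : (insert u σ.1).card = k + 2 := by
      rw [Finset.card_insert_of_notMem hu, σ.2.2]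
    have hSne : (insert u σ.1).Nonempty := Finset.insert_nonempty _ _
    have heq := cycle_erase_eq hk hz hi hcard (Finset.mem_insert_self u σ.1)
      (Finset.min'_mem _ hSne)
    rw [Finset.erase_insert hu, incidence_erase_min', one_mul] at heq
    have hsum : formalBoundary (extendChain c) σ.1 =
        incidence F σ.1 u * extendChain c (insert u σ.1) := by
      rw [formalBoundary, Finset.sum_eq_single u, if_pos hu]
      · intro v _ hvu
        split_ifs with hv
        · rfl
        · rw [extendChain_of_notMem, mul_zero]
          intro h
          have := hi.mem_of_insert_mem (Finset.subset_insert _ _) hσne h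
          simp [hvu, hv] at this
      · simp
    rw [hsum]
    by_cases hS : insert u σ.1 ∈ K
    · rw [extendChain_face c ⟨_, hS, hcard⟩]
      simp only [hcdef]
      rw [if_pos hi, ← heq, ← mul_assoc, incidence_mul_self, one_mul]
    · rw [extendChain_of_notMem c hS, mul_zero]
      suffices h : incidence F σ.1 u * extendChain z σ.1 = 0 from
        ((mul_eq_zero.1 h).resolve_left (incidence_ne_zero _ _)).symm
      by_cases hT' : insert u σ.1 ∈ hollowSets K k
      · rw [heq, hT _ hT']
      -- An isolated set that is neither a face nor hollow misses a facet; `z` vanishes on it, hence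
      -- on every facet by `cycle_erase_eq`.
      · have : ∃ w ∈ insert u σ.1, (insert u σ.1).erase w ∉ K := by
          by_contra! hall
          refine hT' (mem_hollowSets.2 ⟨hcard, hi, fun τ hτ hτne => ?_, hS⟩)
          obtain ⟨w, hw, hwτ⟩ := Finset.exists_of_ssubset hτ
          exact face_mono (hall w hw) (Finset.subset_erase.2 ⟨hτ.1, hwτ⟩) hτne
        obtain ⟨w, hw, hwK⟩ := this
        have h2 := cycle_erase_eq hk hz hi hcard (Finset.mem_insert_self u σ.1) hw
        rw [Finset.erase_insert hu, extendChain_of_notMem z hwK, mul_zero] at h2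
        exact h2

end Betti

/-! ### Two-sided bounds for the Betti number, and hollow sets as components. -/

section Dimension

variable {V : Type*} [LinearOrder V] [Fintype V] {F : Type*} [Field F]

/-- Evaluation of cycles at the chosen faces has its kernel inside the boundaries, so homology is a
quotient of the image of that map. -/
theorem betti_le_card {K : AbstractSimplicialComplex V} {k : ℕ} {ι : Type*} [Fintype ι]
    (e : ι → Face K (k + 1))
    (h : ∀ z, boundary F K k z = 0 → (∀ i, z (e i) = 0) →
      z ∈ LinearMap.range (boundary F K (k + 1))) :
    betti F K k ≤ Fintype.card ι := by
  set Z := LinearMap.ker (boundary F K k)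
  set B := (LinearMap.range (boundary F K (k + 1))).submoduleOf Z
  let Ψ : Z →ₗ[F] (ι → F) := (LinearMap.funLeft F F e).comp Z.subtype
  have hker : LinearMap.ker Ψ ≤ B := by
    intro z hz
    refine h z.1 z.2 fun i => ?_
    exact congrFun (LinearMap.mem_ker.1 hz) i
  calc betti F K k = Module.finrank F (Z ⧸ B) := rfl
    _ ≤ Module.finrank F (Z ⧸ LinearMap.ker Ψ) :=
        LinearMap.finrank_le_finrank_of_surjective (f := Submodule.factor hker)
          (Submodule.factor_surjective hker)
    _ = Module.finrank F (LinearMap.range Ψ) := Ψ.quotKerEquivRange.finrank_eq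
    _ ≤ Module.finrank F (ι → F) := Submodule.finrank_le _
    _ = Fintype.card ι := Module.finrank_fintype_fun_eq_card F

/-- Evaluation at the chosen faces kills boundaries, so it descends to homology, and the given
cycles make it surjective. -/
theorem card_le_betti {K : AbstractSimplicialComplex V} {k : ℕ} {ι : Type*} [Fintype ι]
    [DecidableEq ι] (e : ι → Face K (k + 1))
    (h0 : ∀ (c : Chain F K (k + 2)) (i : ι), boundary F K (k + 1) c (e i) = 0)
    (h1 : ∀ i, ∃ z, boundary F K k z = 0 ∧ ∀ j, z (e j) = (Pi.single i 1 : ι → F) j) :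
    Fintype.card ι ≤ betti F K k := by
  set Z := LinearMap.ker (boundary F K k)
  set B := (LinearMap.range (boundary F K (k + 1))).submoduleOf Z
  let Ψ : Z →ₗ[F] (ι → F) := (LinearMap.funLeft F F e).comp Z.subtype
  have hker : B ≤ LinearMap.ker Ψ := by
    rintro ⟨z, hz⟩ ⟨c, hc⟩
    refine LinearMap.mem_ker.2 (funext fun i => ?_)
    change z (e i) = 0
    rw [← h0 c i]
    exact (congrFun hc (e i)).symm
  have hsurj : Function.Surjective Ψ := by
    rw [← LinearMap.range_eq_top, eq_top_iff, ← (Pi.basisFun F ι).span_eq, Submodule.span_le]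
    rintro _ ⟨i, rfl⟩
    obtain ⟨z, hz, hzi⟩ := h1 i
    refine ⟨⟨z, hz⟩, funext fun j => ?_⟩
    rw [Pi.basisFun_apply]
    exact hzi j
  calc Fintype.card ι = Module.finrank F (ι → F) := (Module.finrank_fintype_fun_eq_card F).symm
    _ ≤ Module.finrank F (Z ⧸ B) :=
        LinearMap.finrank_le_finrank_of_surjective (f := B.liftQ Ψ hker) (by
          intro y
          obtain ⟨x, rfl⟩ := hsurj y
          exact ⟨Submodule.Quotient.mk x, B.liftQ_apply Ψ x⟩)

theorem hollowSets_nonempty {K : AbstractSimplicialComplex V} {k : ℕ} {S : Finset V}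
    (hS : S ∈ hollowSets K k) : S.Nonempty :=
  Finset.card_pos.1 (by rw [(mem_hollowSets.1 hS).1]; omega)

/-- The facet of a hollow set opposite to its least vertex. -/
def hollowFacet (K : AbstractSimplicialComplex V) (k : ℕ) (S : hollowSets K k) : Face K (k + 1) :=
  ⟨S.1.erase (S.1.min' (hollowSets_nonempty S.2)), by
    obtain ⟨hc, -, hf, -⟩ := mem_hollowSets.1 S.2
    have hm := S.1.min'_mem (hollowSets_nonempty S.2)
    have hc' := Finset.card_erase_of_mem hm
    exact ⟨hf _ (Finset.erase_ssubset hm) (Finset.card_pos.1 (by omega)), by omega⟩⟩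

theorem betti_le {K : AbstractSimplicialComplex V} {k : ℕ} (hk : 1 ≤ k) :
    betti F K k ≤ (hollowSets K k).card + (crowdedFaces K k).card := by
  have h := betti_le_card (F := F) (K := K) (k := k) (ι := hollowSets K k ⊕ crowdedFaces K k)
    (Sum.elim (hollowFacet K k) fun σ =>
      ⟨σ.1, (mem_crowdedFaces.1 σ.2).1, (mem_crowdedFaces.1 σ.2).2.1⟩) (by
    intro z hz h
    refine mem_range_boundary hk hz (fun σ hσ => ?_) fun S hS hne => ?_
    · obtain ⟨hσK, hσc, -⟩ := mem_crowdedFaces.1 hσ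
      rw [extendChain_face z ⟨σ, hσK, hσc⟩]
      exact h (Sum.inr ⟨σ, hσ⟩)
    · have := h (Sum.inl ⟨S, hS⟩)
      exact (extendChain_face z (hollowFacet K k ⟨S, hS⟩)).trans this)
  simpa using h

/-- As `T` has at least three vertices, the removed vertex is joined by an edge to the rest of `T`,
and isolation of `S` pulls it into `S`. -/
theorem eq_of_hollowFacet_subset {K : AbstractSimplicialComplex V} {k : ℕ} (hk : 1 ≤ k)
    {S T : Finset V} (hS : S ∈ hollowSets K k) (hT : T ∈ hollowSets K k) {v : V} (hv : v ∈ T)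
    (h : T.erase v ⊆ S) : T = S := by
  obtain ⟨hSc, hSi, -, -⟩ := mem_hollowSets.1 hS
  obtain ⟨hTc, -, hTf, -⟩ := mem_hollowSets.1 hT
  have hc' := Finset.card_erase_of_mem hv
  obtain ⟨a, ha⟩ : (T.erase v).Nonempty := Finset.card_pos.1 (by omega)
  have hvS : v ∈ S := by
    by_contra hvS
    refine hSi a (h ha) v hvS (hTf _ ?_ ⟨a, by simp⟩)
    refine (Finset.ssubset_iff_subset_ne).2 ⟨?_, fun he => ?_⟩
    · intro x hx
      simp only [Finset.mem_insert, Finset.mem_singleton] at hx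
      rcases hx with rfl | rfl
      · exact Finset.mem_of_mem_erase ha
      · exact hv
    · have := Finset.card_le_two (a := a) (b := v)
      rw [he] at this
      omega
  refine Finset.eq_of_subset_of_card_le (fun x hx => ?_) (by omega)
  by_cases hxv : x = v
  · rwa [hxv]
  · exact h (Finset.mem_erase.2 ⟨hxv, hx⟩)

/-- The cycle attached to a hollow `S` is the formal boundary of the missing simplex `S`, all of
whose facets lie in `K`. Boundaries vanish on a facet of `S` because its only possible coface is `S`
itself. -/
theorem card_hollowSets_le_betti {K : AbstractSimplicialComplex V} {k : ℕ} (hk : 1 ≤ k) :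
    (hollowSets K k).card ≤ betti F K k := by
  classical
  rw [← Fintype.card_coe]
  refine card_le_betti (hollowFacet K k) ?_ ?_
  · rintro c ⟨S, hS⟩
    rw [boundary_apply]
    refine Finset.sum_eq_zero fun v _ => ?_
    split_ifs with hv
    · rfl
    · rw [extendChain_of_notMem, mul_zero]
      intro h
      obtain ⟨hSc, hSi, -, hSK⟩ := mem_hollowSets.1 hS
      have hvS := hSi.mem_of_insert_mem (Finset.erase_subset _ _)
        ((K.isRelLowerSet_faces (hollowFacet K k ⟨S, hS⟩).2.1).1) h
      have hvm : v = S.min' (hollowSets_nonempty hS) := by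
        by_contra hvm
        exact hv (Finset.mem_erase.2 ⟨hvm, hvS⟩)
      refine hSK ?_
      rw [← Finset.insert_erase hvS]
      convert h using 2
      simp only [hollowFacet]
      rw [← hvm]
  · rintro ⟨S, hS⟩
    obtain ⟨hSc, hSi, hSf, hSK⟩ := mem_hollowSets.1 hS
    have hval : ∀ σ : Finset V, formalBoundary (Pi.single S 1 : Finset V → F) σ ≠ 0 →
        ∃ v ∉ σ, insert v σ = S := by
      intro σ hσ
      obtain ⟨v, -, hv⟩ := Finset.exists_ne_zero_of_sum_ne_zero hσ
      have hvσ : v ∉ σ := fun hvσ => hv (by simp [hvσ])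
      refine ⟨v, hvσ, ?_⟩
      by_contra hne
      exact hv (by simp [hvσ, Pi.single_eq_of_ne hne])
    let z : Chain F K (k + 1) := fun σ => formalBoundary (Pi.single S 1 : Finset V → F) σ.1
    have hz : extendChain z = formalBoundary (Pi.single S 1 : Finset V → F) := by
      funext σ
      by_cases hσ : σ ∈ K ∧ σ.card = k + 1
      · exact extendChain_face z ⟨σ, hσ⟩
      · rw [extendChain, dif_neg hσ]
        by_contra h
        obtain ⟨v, hv, rfl⟩ := hval σ (Ne.symm h)
        rw [Finset.card_insert_of_notMem hv] at hSc
        exact hσ ⟨hSf σ (Finset.ssubset_insert hv) (Finset.card_pos.1 (by omega)), by omega⟩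
    refine ⟨z, funext fun τ => ?_, ?_⟩
    · rw [boundary_apply, hz, formalBoundary_formalBoundary]; rfl
    · rintro ⟨T, hT⟩
      by_cases hTS : T = S
      · subst hTS
        rw [Pi.single_eq_same]
        change formalBoundary _ (T.erase (T.min' _)) = _
        have hm := T.min'_mem (hollowSets_nonempty hT)
        rw [formalBoundary, Finset.sum_eq_single (T.min' (hollowSets_nonempty hT)),
          if_pos (Finset.notMem_erase _ _), incidence_erase_min', Finset.insert_erase hm,
          Pi.single_eq_same, mul_one]
        · intro v _ hvm
          split_ifs with hv
          · rfl
          · rw [Pi.single_eq_of_ne, mul_zero]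
            intro h
            have : v ∈ T := by rw [← h]; exact Finset.mem_insert_self _ _
            exact hv (Finset.mem_erase.2 ⟨hvm, this⟩)
        · simp
      · rw [Pi.single_eq_of_ne (by simpa using hTS)]
        by_contra h
        obtain ⟨v, hv, hvS⟩ := hval _ h
        refine hTS (eq_of_hollowFacet_subset hk hS hT (T.min'_mem (hollowSets_nonempty hT)) ?_)
        conv_rhs => rw [← hvS]
        exact Finset.subset_insert _ _

/-- The set `s` is kept apart from `S` so that the support of a component can be plugged in without
rewriting inside a dependent type. -/
theorem isomorphic_simplexBoundary_iff {K : AbstractSimplicialComplex V} {k : ℕ} (s : Set V)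
    (S : Finset V) (hs : s = S) :
    Isomorphic (induced K s) (simplexBoundary k) ↔
      S.card = k + 2 ∧ ∀ τ ⊆ S, τ ∈ K ↔ τ.Nonempty ∧ τ ≠ S := by
  classical
  subst hs
  have key : ∀ (e : (S : Set V) ≃ Fin (k + 2)) (σ : Finset (S : Set V)),
      σ.map e.toEmbedding ∈ simplexBoundary k ↔
        (σ.map (Function.Embedding.subtype (· ∈ (S : Set V)))).Nonempty ∧
          σ.map (Function.Embedding.subtype (· ∈ (S : Set V))) ≠ S := by
    intro e σ
    change (σ.map e.toEmbedding).Nonempty ∧ σ.map e.toEmbedding ≠ Finset.univ ↔ _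
    rw [Finset.map_nonempty, Finset.map_nonempty]
    refine and_congr_right fun _ => not_congr ?_
    have h1 : σ.map e.toEmbedding = Finset.univ ↔ σ = Finset.univ := by
      rw [← Finset.map_univ_equiv e, Finset.map_inj]
    have h2 : (Finset.univ : Finset (S : Set V)).map
        (Function.Embedding.subtype (· ∈ (S : Set V))) = S := by
      ext x; simp
    rw [h1, ← Finset.map_inj (f := Function.Embedding.subtype (· ∈ (S : Set V))), h2]
  constructor
  · rintro ⟨e, he⟩
    refine ⟨by simpa using Fintype.card_congr e, fun τ hτ => ?_⟩
    have := he (τ.subtype (· ∈ (S : Set V)))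
    rw [key] at this
    have hτ' : (τ.subtype (· ∈ (S : Set V))).map
        (Function.Embedding.subtype (· ∈ (S : Set V))) = τ := by
      rw [Finset.subtype_map]
      exact Finset.filter_true_of_mem fun x hx => hτ hx
    rw [hτ'] at this
    rw [← this]
    change _ ↔ Finset.map _ _ ∈ K
    rw [hτ']
  · rintro ⟨hc, h⟩
    refine ⟨Fintype.equivFinOfCardEq (by simpa using hc), fun σ => ?_⟩
    rw [key]
    refine h _ fun x hx => ?_
    obtain ⟨y, -, rfl⟩ := Finset.mem_map.1 hx
    exact y.2

/-- A hollow set is a whole component: for `k ≥ 1` every pair in it is a proper subset, hence an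
edge, and isolation lets no path leave. -/
theorem boundaryComponents_eq {K : AbstractSimplicialComplex V} {k : ℕ} (hk : 1 ≤ k) :
    boundaryComponents K k = (hollowSets K k).card := by
  classical
  rw [← Nat.card_eq_finsetCard]
  have hcoe : ∀ c : (skeletonGraph K).ConnectedComponent, c.supp = (c.supp.toFinset : Set V) :=
    fun c => by simp
  refine Nat.card_eq_of_bijective (fun c => ⟨c.1.supp.toFinset, ?_⟩) ⟨?_, ?_⟩
  · obtain ⟨c, hc⟩ := c
    obtain ⟨hcard, hf⟩ := (isomorphic_simplexBoundary_iff _ _ (hcoe c)).1 hc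
    refine mem_hollowSets.2 ⟨hcard, fun a ha b hb hab => hb ?_, fun τ hτ hne => ?_, fun h => ?_⟩
    · rw [Set.mem_toFinset] at ha ⊢
      refine c.mem_supp_of_adj_mem_supp ha ⟨?_, hab⟩
      rintro rfl
      exact hb (Set.mem_toFinset.2 ha)
    · exact (hf τ hτ.1).2 ⟨hne, hτ.ne⟩
    · exact ((hf _ subset_rfl).1 h).2 rfl
  · rintro ⟨c, hc⟩ ⟨c', hc'⟩ h
    have : c.supp = c'.supp := Set.toFinset_inj.1 (congrArg Subtype.val h)
    exact Subtype.ext (SimpleGraph.ConnectedComponent.supp_injective this)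
  · rintro ⟨S, hS⟩
    obtain ⟨hcard, hi, hf, hSK⟩ := mem_hollowSets.1 hS
    obtain ⟨a, ha⟩ := hollowSets_nonempty hS
    have hsupp : ((skeletonGraph K).connectedComponentMk a).supp = (S : Set V) := by
      ext b
      rw [SimpleGraph.ConnectedComponent.mem_supp_iff, SimpleGraph.ConnectedComponent.eq]
      constructor
      · intro h
        obtain ⟨w⟩ := h.symm
        clear h
        induction w with
        | nil => exact ha
        | @cons u v _ huv _ ih =>
          refine ih ?_
          by_contra hv
          exact hi u ha v hv huv.2
      · intro hb
        by_cases hab : a = b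
        · rw [hab]
        · refine SimpleGraph.Adj.reachable ⟨Ne.symm hab, hf _ ?_ ⟨a, by simp⟩⟩
          refine (Finset.ssubset_iff_subset_ne).2 ⟨?_, fun he => ?_⟩
          · intro x hx
            simp only [Finset.mem_insert, Finset.mem_singleton] at hx
            rcases hx with rfl | rfl
            · exact hb
            · exact ha
          · have := Finset.card_le_two (a := b) (b := a)
            rw [he] at this
            omega
    refine ⟨⟨_, (isomorphic_simplexBoundary_iff _ _ hsupp).2 ⟨hcard, fun τ hτ => ?_⟩⟩,
      Subtype.ext ?_⟩
    · constructor
      · exact fun h => ⟨(K.isRelLowerSet_faces h).1, fun he => hSK (he ▸ h)⟩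
      · exact fun h => hf τ (hτ.ssubset_of_ne h.2) h.1
    · ext x
      simp [hsupp]

end Dimension

/-! ### Probabilities that independent points are close together. -/

section Points

/-- The points with indices in `S` are pairwise within distance `r`. -/
def clique {ι E : Type*} [PseudoMetricSpace E] (S : Finset ι) (r : ℝ) : Set (ι → E) :=
  {x | ∀ i ∈ S, ∀ j ∈ S, dist (x i) (x j) ≤ r}

section Measurability

variable {ι E : Type*} [PseudoMetricSpace E] [MeasurableSpace E] [OpensMeasurableSpace E]
  [SecondCountableTopology E]

theorem measurableSet_dist_le (i j : ι) (r : ℝ) :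
    MeasurableSet {x : ι → E | dist (x i) (x j) ≤ r} :=
  measurableSet_le ((measurable_pi_apply i).dist (measurable_pi_apply j)) measurable_const

theorem measurableSet_star (a : ι) (T : Finset ι) (r : ℝ) :
    MeasurableSet {x : ι → E | ∀ i ∈ T, dist (x a) (x i) ≤ r} := by
  simp only [Set.ofPred_forall]
  exact Finset.measurableSet_biInter _ fun i _ => measurableSet_dist_le a i r

theorem measurableSet_clique (S : Finset ι) (r : ℝ) :
    MeasurableSet (clique S r : Set (ι → E)) := by
  simp only [clique, Set.ofPred_forall]
  exact Finset.measurableSet_biInter _ fun i _ => Finset.measurableSet_biInter _ fun j _ =>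
    measurableSet_dist_le i j r

end Measurability

theorem pi_forall_mem {ι E : Type*} [Fintype ι] [DecidableEq ι] [MeasurableSpace E]
    (μ : Measure E) [IsProbabilityMeasure μ] (S : Finset ι) (B : Set E) :
    Measure.pi (fun _ : ι => μ) {x | ∀ i ∈ S, x i ∈ B} = μ B ^ S.card := by
  have h : {x : ι → E | ∀ i ∈ S, x i ∈ B} =
      Set.univ.pi fun i => if i ∈ S then B else Set.univ := by
    ext x
    simp only [Set.mem_ofPred_eq, Set.mem_univ_pi]
    refine forall_congr' fun i => ?_
    by_cases hi : i ∈ S <;> simp [hi]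
  rw [h, Measure.pi_pi]
  simp [apply_ite μ]


variable {ι E : Type*} [Fintype ι] [DecidableEq ι] [PseudoMetricSpace E] [MeasurableSpace E]
  [OpensMeasurableSpace E] [SecondCountableTopology E]

/-- Requiring a free point to be close to another one costs a factor `ε`. -/
theorem pi_inter_dist_le (μ : Measure E) [IsProbabilityMeasure μ] {r : ℝ} {ε : ENNReal}
    (hε : ∀ x, μ (Metric.closedBall x r) ≤ ε) {A : Set (ι → E)} (hA : MeasurableSet A) {i j : ι}
    (hij : i ≠ j) (hAj : ∀ x y, Function.update x j y ∈ A ↔ x ∈ A) :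
    Measure.pi (fun _ : ι => μ) (A ∩ {x | dist (x i) (x j) ≤ r}) ≤
      ε * Measure.pi (fun _ : ι => μ) A := by
  have hB := hA.inter (measurableSet_dist_le (E := E) i j r)
  rw [← lintegral_indicator_one hB, ← lintegral_indicator_one hA,
    ← lintegral_const_mul _ (measurable_one.indicator hA)]
  -- It suffices to integrate out coordinate `j`: with the others fixed, membership in `A` is
  -- constant and point `j` is confined to a ball around `x i`.
  refine lintegral_le_of_lmarginal_le {j} (measurable_one.indicator hB)
    ((measurable_one.indicator hA).const_mul _) fun x => ?_
  rw [lmarginal_singleton, lmarginal_singleton]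
  by_cases hx : x ∈ A
  · have h1 : ∀ y, (A ∩ {x | dist (x i) (x j) ≤ r}).indicator (1 : (ι → E) → ENNReal)
        (Function.update x j y) = (Metric.closedBall (x i) r).indicator 1 y := by
      intro y
      classical simp [Set.indicator_apply, hAj, hx, hij, dist_comm]
    have h2 : ∀ y, A.indicator (1 : (ι → E) → ENNReal) (Function.update x j y) = 1 := by
      intro y
      simp [hAj, hx]
    change ∫⁻ y, (A ∩ {x | dist (x i) (x j) ≤ r}).indicator (1 : (ι → E) → ENNReal)
      (Function.update x j y) ∂μ ≤
        ∫⁻ y, ε * A.indicator (1 : (ι → E) → ENNReal) (Function.update x j y) ∂μ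
    simp only [h1, h2]
    rw [lintegral_indicator_one Metric.isClosed_closedBall.measurableSet]
    simpa using hε (x i)
  · simp [hAj, hx]

/-- For upper bounds a clique is relaxed to a star, in which each leaf is free and costs one factor
`ε`. -/
theorem pi_star_le (μ : Measure E) [IsProbabilityMeasure μ] {r : ℝ} {ε : ENNReal}
    (hε : ∀ x, μ (Metric.closedBall x r) ≤ ε) {a : ι} {T : Finset ι} (ha : a ∉ T) :
    Measure.pi (fun _ : ι => μ) {x | ∀ i ∈ T, dist (x a) (x i) ≤ r} ≤ ε ^ T.card := by
  induction T using Finset.induction_on with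
  | empty => simp
  | insert j T hj ih =>
    simp only [Finset.mem_insert, not_or] at ha
    have h : {x : ι → E | ∀ i ∈ insert j T, dist (x a) (x i) ≤ r} =
        {x | ∀ i ∈ T, dist (x a) (x i) ≤ r} ∩ {x | dist (x a) (x j) ≤ r} := by
      ext x; simp [and_comm]
    rw [h, Finset.card_insert_of_notMem hj, pow_succ']
    refine (pi_inter_dist_le μ hε (measurableSet_star a T r) ha.1 fun x y => ?_).trans ?_
    · refine forall₂_congr fun i hi => ?_
      rw [Function.update_of_ne ha.1, Function.update_of_ne (ne_of_mem_of_not_mem hi hj)]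
    · gcongr
      exact ih ha.2

/-- Here `v` is integrated out before `u`, because `c` may equal `u` while no other condition
involves `v`. -/
theorem pi_star_extend_le (μ : Measure E) [IsProbabilityMeasure μ] {r : ℝ} {ε : ENNReal}
    (hε : ∀ x, μ (Metric.closedBall x r) ≤ ε) {a b c u v : ι} {T : Finset ι} (ha : a ∉ T)
    (hb : b ∈ insert a T) (hu : u ∉ insert a T) (hc : c ∈ insert u (insert a T))
    (hv : v ∉ insert u (insert a T)) :
    Measure.pi (fun _ : ι => μ) {x | (∀ i ∈ T, dist (x a) (x i) ≤ r) ∧ dist (x b) (x u) ≤ r ∧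
      dist (x c) (x v) ≤ r} ≤ ε ^ (T.card + 2) := by
  have hstar := measurableSet_star (E := E) a T r
  have h : {x : ι → E | (∀ i ∈ T, dist (x a) (x i) ≤ r) ∧ dist (x b) (x u) ≤ r ∧
      dist (x c) (x v) ≤ r} = ({x | ∀ i ∈ T, dist (x a) (x i) ≤ r} ∩
        {x | dist (x b) (x u) ≤ r}) ∩ {x | dist (x c) (x v) ≤ r} := by
    ext x; simp [and_assoc]
  have hT : ∀ {w}, w ∉ insert a T → ∀ (x : ι → E) y,
      (∀ i ∈ T, dist (Function.update x w y a) (Function.update x w y i) ≤ r) ↔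
        ∀ i ∈ T, dist (x a) (x i) ≤ r := by
    intro w hw x y
    simp only [Finset.mem_insert, not_or] at hw
    refine forall₂_congr fun i hi => ?_
    rw [Function.update_of_ne (Ne.symm hw.1), Function.update_of_ne (ne_of_mem_of_not_mem hi hw.2)]
  have hv' : v ∉ insert a T := fun h => hv (Finset.mem_insert_of_mem h)
  rw [h, pow_add, pow_two, mul_comm, mul_assoc]
  refine (pi_inter_dist_le μ hε (hstar.inter (measurableSet_dist_le _ _ _))
    (ne_of_mem_of_not_mem hc hv) fun x y => and_congr (hT hv' x y) ?_).trans ?_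
  · change dist _ _ ≤ r ↔ dist _ _ ≤ r
    rw [Function.update_of_ne (ne_of_mem_of_not_mem hb hv'),
      Function.update_of_ne (ne_of_mem_of_not_mem (Finset.mem_insert_self _ _) hv)]
  · gcongr
    refine (pi_inter_dist_le μ hε hstar (ne_of_mem_of_not_mem hb hu) (hT hu)).trans ?_
    gcongr
    exact pi_star_le μ hε ha

/-- A clique is isolated with probability close to one. -/
theorem le_pi_isolated_clique (μ : Measure E) [IsProbabilityMeasure μ] {r : ℝ} {ε : ENNReal}
    (hε : ∀ x, μ (Metric.closedBall x r) ≤ ε) (S : Finset ι) :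
    Measure.pi (fun _ : ι => μ) (clique S r) ≤
      Measure.pi (fun _ : ι => μ) (clique S r ∩ {x | ∀ i ∈ S, ∀ j ∉ S, r < dist (x i) (x j)}) +
        (S.card * Fintype.card ι : ℕ) * (ε * Measure.pi (fun _ : ι => μ) (clique S r)) := by
  set P := Measure.pi (fun _ : ι => μ)
  have hsub : (clique S r : Set (ι → E)) ⊆
      (clique S r ∩ {x | ∀ i ∈ S, ∀ j ∉ S, r < dist (x i) (x j)}) ∪
        ⋃ q ∈ S ×ˢ Sᶜ, clique S r ∩ {x | dist (x q.1) (x q.2) ≤ r} := by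
    intro x hx
    by_cases h : ∀ i ∈ S, ∀ j ∉ S, r < dist (x i) (x j)
    · exact Or.inl ⟨hx, h⟩
    · push Not at h
      obtain ⟨i, hi, j, hj, hij⟩ := h
      refine Or.inr (Set.mem_biUnion (x := (i, j)) ?_ ⟨hx, hij⟩)
      simp [hi, hj]
  refine (measure_mono hsub).trans ((measure_union_le _ _).trans ?_)
  gcongr
  refine (measure_biUnion_finset_le _ _).trans ?_
  refine (Finset.sum_le_card_nsmul _ _ (ε * P (clique S r)) fun q hq => ?_).trans ?_
  · simp only [Finset.mem_product, Finset.mem_compl] at hq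
    refine pi_inter_dist_le μ hε (measurableSet_clique S r) (ne_of_mem_of_not_mem hq.1 hq.2)
      fun x y => forall₂_congr fun i hi => forall₂_congr fun j hj => ?_
    rw [Function.update_of_ne (ne_of_mem_of_not_mem hi hq.2),
      Function.update_of_ne (ne_of_mem_of_not_mem hj hq.2)]
  · rw [nsmul_eq_mul, Finset.card_product]
    gcongr
    exact Finset.card_le_univ _

end Points

/-- Hölder's inequality against the constant `1`, with exponents `m + 1` and `(m + 1) / m`. -/
theorem pow_lintegral_le {α : Type*} [MeasurableSpace α] (ν : Measure α) {g : α → ENNReal}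
    (hg : AEMeasurable g ν) {m : ℕ} (hm : 1 ≤ m) :
    (∫⁻ y, g y ∂ν) ^ (m + 1) ≤ (∫⁻ y, g y ^ (m + 1) ∂ν) * ν Set.univ ^ m := by
  have hpq : (m + 1 : ℝ).HolderConjugate ((m + 1) / m) := by
    have : (0 : ℝ) < m := by exact_mod_cast hm
    rw [Real.holderConjugate_iff]
    constructor
    · linarith
    · field_simp
      ring
  have h := ENNReal.lintegral_mul_le_Lp_mul_Lq ν hpq hg (aemeasurable_const (b := 1))
  simp only [Pi.mul_apply, mul_one, ENNReal.one_rpow, lintegral_const, one_mul] at h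
  have h' := ENNReal.rpow_le_rpow h (z := m + 1) (by positivity)
  have hm0 : (m : ℝ) ≠ 0 := by positivity
  have hm1 : (m : ℝ) + 1 ≠ 0 := by positivity
  rw [ENNReal.mul_rpow_of_nonneg _ _ (by positivity), ← ENNReal.rpow_mul, ← ENNReal.rpow_mul] at h'
  rw [one_div_mul_cancel hm1, ENNReal.rpow_one] at h'
  have e : 1 / (((m : ℝ) + 1) / m) * (m + 1) = m := by field_simp
  rw [e] at h'
  have e2 : ((m : ℝ) + 1) = ((m + 1 : ℕ) : ℝ) := by push_cast; rfl
  simp only [e2, ENNReal.rpow_natCast] at h'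
  exact h'

/-- Independent points with any common law form a clique of size `m + 1` with probability at least
of the order `r ^ (d * m)`. -/
theorem exists_le_pi_clique {d : ℕ} (μ : Measure (EuclideanSpace ℝ (Fin d)))
    [IsProbabilityMeasure μ] {m : ℕ} (hm : 1 ≤ m) :
    ∃ c : ℝ, 0 < c ∧ ∀ (n : ℕ) (S : Finset (Fin n)), S.card = m + 1 → ∀ r : ℝ, 0 < r → r ≤ 1 →
      c * (r ^ d) ^ m ≤ (Measure.pi fun _ : Fin n => μ).real (clique S r) := by
  obtain ⟨R, hR⟩ : ∃ R : ℕ, (1 / 2 : ENNReal) ≤ μ (Metric.closedBall 0 (R : ℝ)) := by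
    have h : Tendsto (fun R : ℕ => μ (Metric.closedBall 0 (R : ℝ))) atTop (𝓝 1) := by
      have := tendsto_measure_iUnion_atTop (μ := μ)
        (s := fun R : ℕ => Metric.closedBall (0 : EuclideanSpace ℝ (Fin d)) (R : ℝ))
        fun a b hab => Metric.closedBall_subset_closedBall (by exact_mod_cast hab)
      rwa [Metric.iUnion_closedBall_nat, measure_univ] at this
    have h2 : (1 / 2 : ENNReal) < 1 := by
      rw [one_div]; exact ENNReal.one_half_lt_one
    exact ((h.eventually (lt_mem_nhds h2)).exists).imp fun _ => le_of_lt
  -- The extra unit of radius keeps every `r / 2`-ball centred in the ball of radius `R` inside `W`.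
  -- The plan is to average over a centre `y ∈ W`: points that all lie within `r / 2` of `y` form a
  -- clique.
  set W := Metric.closedBall (0 : EuclideanSpace ℝ (Fin d)) (R + 1) with hW
  set v1 := volume.real (Metric.ball (0 : EuclideanSpace ℝ (Fin d)) 1) with hv1
  have hv1pos : 0 < v1 := ENNReal.toReal_pos (Metric.measure_ball_pos _ _ one_pos).ne'
    measure_ball_lt_top.ne
  have hWtop : volume W ≠ ⊤ := measure_closedBall_lt_top.ne
  have hWpos : 0 < volume.real W := ENNReal.toReal_pos
    (Metric.measure_closedBall_pos _ _ (by positivity)).ne' hWtop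
  refine ⟨v1 ^ m / ((2 ^ d) ^ m * 2 ^ (m + 1) * volume.real W ^ m), by positivity, ?_⟩
  intro n S hS r hr hr1
  set P := Measure.pi fun _ : Fin n => μ
  set ball := fun y : EuclideanSpace ℝ (Fin d) => Metric.closedBall y (r / 2) with hball
  set V := volume (ball 0) with hV
  have hVx : ∀ x, volume (ball x) = V := fun x => by
    rw [hV, hball]; simp only []; rw [Measure.addHaar_closedBall_center]
  have hVtop : V ≠ ⊤ := measure_closedBall_lt_top.ne
  have hmeas2 : MeasurableSet {q : EuclideanSpace ℝ (Fin d) × EuclideanSpace ℝ (Fin d) |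
      q.2 ∈ ball q.1} :=
    (isClosed_le (continuous_snd.dist continuous_fst) continuous_const).measurableSet
  have hg : Measurable fun y => μ (ball y) := measurable_measure_prodMk_left hmeas2
  -- By Fubini, each point of the ball of radius `R`, which has mass at least `1 / 2`, is covered by
  -- a volume `V` of centres.
  have hmass : V / 2 ≤ ∫⁻ y in W, μ (ball y) := by
    have e1 : ∫⁻ y in W, μ (ball y) = (volume.restrict W).prod μ {q | q.2 ∈ ball q.1} := by
      rw [Measure.prod_apply hmeas2]; rfl
    rw [e1, Measure.prod_apply_symm hmeas2]
    calc V / 2 = V * (1 / 2) := by rw [one_div]; rfl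
      _ ≤ V * μ (Metric.closedBall 0 (R : ℝ)) := by gcongr
      _ = ∫⁻ x in Metric.closedBall 0 (R : ℝ), V ∂μ := by simp
      _ ≤ ∫⁻ x in Metric.closedBall 0 (R : ℝ),
          (volume.restrict W) ((fun y => (y, x)) ⁻¹' {q | q.2 ∈ ball q.1}) ∂μ := by
        refine setLIntegral_mono' Metric.isClosed_closedBall.measurableSet fun x hx => ?_
        have e2 : (fun y => (y, x)) ⁻¹' {q | q.2 ∈ ball q.1} = ball x := by
          ext y
          simp [hball, dist_comm]
        rw [e2, Measure.restrict_apply Metric.isClosed_closedBall.measurableSet,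
          Set.inter_eq_left.2, hVx]
        intro y hy
        replace hy : dist y x ≤ r / 2 := hy
        rw [Metric.mem_closedBall] at hx
        rw [hW, Metric.mem_closedBall]
        linarith [dist_triangle y x 0]
      _ ≤ _ := setLIntegral_le_lintegral _ _
  -- By Fubini again: the admissible centres of a configuration lie in one ball of volume `V`, and
  -- there are none unless it is a clique.
  have hfub : ∫⁻ y in W, μ (ball y) ^ (m + 1) ≤ V * P (clique S r) := by
    have hmeas : MeasurableSet {q : EuclideanSpace ℝ (Fin d) × (Fin n → EuclideanSpace ℝ (Fin d)) |
        ∀ i ∈ S, q.2 i ∈ ball q.1} := by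
      simp only [Set.ofPred_forall]
      refine Finset.measurableSet_biInter _ fun i _ => IsClosed.measurableSet ?_
      exact isClosed_le (((continuous_apply i).comp continuous_snd).dist continuous_fst)
        continuous_const
    have e1 : ∫⁻ y in W, μ (ball y) ^ (m + 1) =
        (volume.restrict W).prod P {q | ∀ i ∈ S, q.2 i ∈ ball q.1} := by
      rw [Measure.prod_apply hmeas]
      refine lintegral_congr fun y => ?_
      rw [← hS, ← pi_forall_mem]; rfl
    rw [e1, Measure.prod_apply_symm hmeas, ← lintegral_indicator_const (measurableSet_clique S r)]
    refine lintegral_mono fun x => ?_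
    obtain ⟨i₀, hi₀⟩ : S.Nonempty := Finset.card_pos.1 (by omega)
    by_cases hx : x ∈ clique S r
    · rw [Set.indicator_of_mem hx, ← hVx (x i₀)]
      refine (Measure.restrict_apply_le _ _).trans (measure_mono fun y hy => ?_)
      have : x i₀ ∈ ball y := hy i₀ hi₀
      simpa [hball, dist_comm] using this
    · rw [Set.indicator_of_notMem hx]
      have : (fun y => (y, x)) ⁻¹' {q : EuclideanSpace ℝ (Fin d) ×
          (Fin n → EuclideanSpace ℝ (Fin d)) | ∀ i ∈ S, q.2 i ∈ ball q.1} = ∅ := by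
        refine Set.eq_empty_of_forall_notMem fun y hy => hx fun i hi j hj => ?_
        have h1 : dist (x i) y ≤ r / 2 := hy i hi
        have h2 : dist (x j) y ≤ r / 2 := hy j hj
        linarith [dist_triangle_right (x i) (x j) y]
      rw [this, measure_empty]
  have hmain : (V / 2) ^ (m + 1) ≤ V * P (clique S r) * volume W ^ m := by
    calc (V / 2) ^ (m + 1) ≤ (∫⁻ y in W, μ (ball y)) ^ (m + 1) := by gcongr
      _ ≤ (∫⁻ y in W, μ (ball y) ^ (m + 1)) * (volume.restrict W) Set.univ ^ m :=
        pow_lintegral_le _ hg.aemeasurable hm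
      _ ≤ _ := by
        rw [Measure.restrict_apply_univ]
        gcongr
  have hreal := ENNReal.toReal_mono (by finiteness) hmain
  rw [ENNReal.toReal_pow, ENNReal.toReal_div, ENNReal.toReal_mul, ENNReal.toReal_mul,
    ENNReal.toReal_pow] at hreal
  have hVreal : V.toReal = (r / 2) ^ d * v1 := by
    rw [hV, hball]
    simp only []
    rw [Measure.addHaar_closedBall _ _ (by positivity), ENNReal.toReal_mul,
      ENNReal.toReal_ofReal (by positivity), finrank_euclideanSpace, Fintype.card_fin]
    rfl
  have hVpos : 0 < V.toReal := by rw [hVreal]; positivity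
  change (V.toReal / (2 : ENNReal).toReal) ^ (m + 1) ≤
    V.toReal * P.real (clique S r) * volume.real W ^ m at hreal
  have h3 : V.toReal ^ m / 2 ^ (m + 1) ≤ P.real (clique S r) * volume.real W ^ m := by
    rw [← mul_le_mul_iff_right₀ hVpos]
    calc V.toReal * (V.toReal ^ m / 2 ^ (m + 1)) =
        (V.toReal / (2 : ENNReal).toReal) ^ (m + 1) := by
          rw [ENNReal.toReal_ofNat, div_pow, pow_succ' V.toReal]; ring
      _ ≤ _ := hreal.trans_eq (by ring)
  rw [hVreal] at h3
  calc v1 ^ m / ((2 ^ d) ^ m * 2 ^ (m + 1) * volume.real W ^ m) * (r ^ d) ^ m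
      = ((r / 2) ^ d * v1) ^ m / 2 ^ (m + 1) / volume.real W ^ m := by
        rw [mul_pow, div_pow, div_pow]; field_simp
    _ ≤ _ := by rwa [div_le_iff₀ (by positivity)]

/-! ### Membership in the random complex, and measurability. -/

section Membership

theorem closedBall_inter_closedBall_nonempty_iff {E : Type*} [NormedAddCommGroup E]
    [NormedSpace ℝ E] {x y : E} {r : ℝ} :
    (Metric.closedBall x (r / 2) ∩ Metric.closedBall y (r / 2)).Nonempty ↔ dist x y ≤ r := by
  constructor
  · rintro ⟨z, hx, hy⟩
    rw [Metric.mem_closedBall] at hx hy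
    linarith [dist_triangle_left x y z]
  · intro h
    refine ⟨midpoint ℝ x y, ?_, ?_⟩
    · rw [Metric.mem_closedBall, dist_midpoint_left, Real.norm_ofNat]
      linarith
    · rw [Metric.mem_closedBall, dist_midpoint_right, Real.norm_ofNat]
      linarith

theorem mem_softRips_iff {d n : ℕ} {r : ℝ} {ω : Sample d n} {σ : Finset (Fin n)} :
    σ ∈ softRips r ω ↔ σ.Nonempty ∧ (∀ i ∈ σ, ∀ j ∈ σ, i ≠ j → dist (ω.1 i) (ω.1 j) ≤ r) ∧
      ∀ τ ⊆ σ, 2 ≤ τ.card → ω.2 τ = true := by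
  change (σ.Nonempty ∧ ∀ i ∈ σ, ∀ j ∈ σ, i ≠ j →
    (Metric.closedBall (ω.1 i) (r / 2) ∩ Metric.closedBall (ω.1 j) (r / 2)).Nonempty) ∧ _ ↔ _
  simp only [closedBall_inter_closedBall_nonempty_iff, and_assoc]

theorem dist_le_of_pair_mem_softRips {d n : ℕ} {r : ℝ} {ω : Sample d n} {i j : Fin n}
    (hij : i ≠ j) (h : ({i, j} : Finset (Fin n)) ∈ softRips r ω) : dist (ω.1 i) (ω.1 j) ≤ r :=
  (mem_softRips_iff.1 h).2.1 i (by simp) j (by simp) hij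

end Membership

section Measurability

/-- Because of this finiteness, every real function of the random complex is measurable and bounded,
whatever its definition. -/
instance {V : Type*} [Finite V] : Finite (AbstractSimplicialComplex V) :=
  Finite.of_injective (fun K : AbstractSimplicialComplex V => K.faces) fun _ _ h =>
    AbstractSimplicialComplex.ext h

theorem measurableSet_mem_softRips {d n : ℕ} (r : ℝ) (σ : Finset (Fin n)) :
    MeasurableSet {ω : Sample d n | σ ∈ softRips r ω} := by
  simp only [mem_softRips_iff, Set.ofPred_and, Set.ofPred_forall]
  refine (MeasurableSet.const _).inter (MeasurableSet.inter ?_ ?_)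
  · refine MeasurableSet.iInter fun i => MeasurableSet.iInter fun _ => MeasurableSet.iInter fun j =>
      MeasurableSet.iInter fun _ => MeasurableSet.iInter fun _ => ?_
    exact measurable_fst (measurableSet_dist_le i j r)
  · refine MeasurableSet.iInter fun τ => MeasurableSet.iInter fun _ => MeasurableSet.iInter fun _ =>
      ?_
    have : Measurable fun ω : Sample d n => ω.2 τ := (measurable_pi_apply τ).comp measurable_snd
    exact this (measurableSet_singleton true)

theorem measurable_comp_softRips {d n : ℕ} (r : ℝ) {β : Type*} [MeasurableSpace β]
    (g : AbstractSimplicialComplex (Fin n) → β) :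
    Measurable fun ω : Sample d n => g (softRips r ω) := by
  intro s _
  have h : (fun ω : Sample d n => g (softRips r ω)) ⁻¹' s =
      ⋃ K ∈ g ⁻¹' s, ⋂ σ, {ω | σ ∈ softRips r ω ↔ σ ∈ K} := by
    ext ω
    simp only [Set.mem_preimage, Set.mem_iUnion, Set.mem_iInter, Set.mem_ofPred_eq, exists_prop]
    constructor
    · exact fun h => ⟨_, h, fun _ => Iff.rfl⟩
    · rintro ⟨K, hK, h⟩
      have : softRips r ω = K := AbstractSimplicialComplex.ext (Set.ext h)
      rwa [this]
  rw [h]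
  refine MeasurableSet.biUnion (Set.to_countable _) fun K _ => MeasurableSet.iInter fun σ => ?_
  by_cases hσ : σ ∈ K
  · simpa [hσ] using measurableSet_mem_softRips r σ
  · have : {ω : Sample d n | σ ∈ softRips r ω ↔ σ ∈ K} = {ω | σ ∈ softRips r ω}ᶜ := by
      ext ω; simp [hσ]
    rw [this]
    exact (measurableSet_mem_softRips r σ).compl

theorem integrable_comp_softRips {d n : ℕ} (r : ℝ) (P : Measure (Sample d n)) [IsFiniteMeasure P]
    (g : AbstractSimplicialComplex (Fin n) → ℝ) :
    Integrable (fun ω => g (softRips r ω)) P := by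
  obtain ⟨C, hC⟩ := (Set.finite_range fun K => ‖g K‖).bddAbove
  exact Integrable.of_bound (measurable_comp_softRips r g).aestronglyMeasurable C
    (ae_of_all _ fun ω => hC ⟨_, rfl⟩)

theorem integral_card_softRips {d n : ℕ} (r : ℝ) (P : Measure (Sample d n)) [IsFiniteMeasure P]
    (g : AbstractSimplicialComplex (Fin n) → Finset (Finset (Fin n))) :
    ∫ ω, ((g (softRips r ω)).card : ℝ) ∂P = ∑ S, P.real {ω | S ∈ g (softRips r ω)} := by
  have hm : ∀ S, MeasurableSet {ω : Sample d n | S ∈ g (softRips r ω)} := fun S =>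
    measurableSet_setOfPred.2 (measurable_comp_softRips r fun K => S ∈ g K)
  have h : ∀ ω : Sample d n, ((g (softRips r ω)).card : ℝ) =
      ∑ S, {ω | S ∈ g (softRips r ω)}.indicator 1 ω := by
    intro ω
    classical
    simp [Set.indicator_apply]
  simp only [h]
  rw [integral_finsetSum _ fun S _ => (integrable_const 1).indicator (hm S)]
  exact Finset.sum_congr rfl fun S _ => integral_indicator_one (hm S)

end Measurability

/-! ### Probabilities of coin patterns. -/

section Coins

theorem pi_bernoulli_real {α : Type*} [Fintype α] [DecidableEq α] (q : α → unitInterval)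
    (A : Finset α) (b : α → Bool) :
    (Measure.pi fun a => bernoulliMeasure true false (q a)).real {ξ | ∀ a ∈ A, ξ a = b a} =
      ∏ a ∈ A, if b a then (q a : ℝ) else 1 - q a := by
  have h : {ξ : α → Bool | ∀ a ∈ A, ξ a = b a} =
      Set.univ.pi fun a => if a ∈ A then {b a} else Set.univ := by
    ext x
    simp only [Set.mem_ofPred_eq, Set.mem_univ_pi]
    refine forall_congr' fun i => ?_
    by_cases hi : i ∈ A <;> simp [hi]
  rw [h, measureReal_def, Measure.pi_pi, ENNReal.toReal_prod,
    ← Finset.prod_subset (Finset.subset_univ A)]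
  · refine Finset.prod_congr rfl fun a ha => ?_
    rw [if_pos ha]
    change (bernoulliMeasure true false (q a)).real {b a} = _
    cases b a
    · rw [bernoulliMeasure_real_apply_of_notMem_of_mem _ (measurableSet_singleton _) (by simp)
        (by simp)]
      simp
    · rw [bernoulliMeasure_real_apply_of_mem_of_notMem _ (measurableSet_singleton _) (by simp)
        (by simp)]
      simp
  · intro a _ ha
    simp [ha]

/-- The faces of positive dimension at most `k` of the simplex on `S`. -/
def lowFaces {α : Type*} (S : Finset α) (k : ℕ) : Finset (Finset α) :=
  S.powerset.filter fun τ => 2 ≤ τ.card ∧ τ.card ≤ k + 1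

theorem mem_lowFaces {α : Type*} {S τ : Finset α} {k : ℕ} :
    τ ∈ lowFaces S k ↔ τ ⊆ S ∧ 2 ≤ τ.card ∧ τ.card ≤ k + 1 := by
  simp [lowFaces]

theorem prod_lowFaces {α : Type*} (S : Finset α) (k : ℕ) (g : ℕ → ℝ) :
    ∏ τ ∈ lowFaces S k, g (τ.card - 1) = ∏ i ∈ Finset.Icc 1 k, g i ^ S.card.choose (i + 1) := by
  classical
  rw [← Finset.prod_fiberwise_of_maps_to (s := lowFaces S k) (t := Finset.Icc 1 k)
    (g := fun τ => τ.card - 1)]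
  · refine Finset.prod_congr rfl fun i hi => ?_
    rw [Finset.mem_Icc] at hi
    have : (lowFaces S k).filter (fun τ => τ.card - 1 = i) = S.powersetCard (i + 1) := by
      ext τ
      simp only [Finset.mem_filter, mem_lowFaces, Finset.mem_powersetCard]
      constructor
      · rintro ⟨⟨h, h2, -⟩, h3⟩
        exact ⟨h, by omega⟩
      · rintro ⟨h, h2⟩
        exact ⟨⟨h, by omega⟩, by omega⟩
    rw [this, ← Finset.card_powersetCard, ← Finset.prod_const]
    refine Finset.prod_congr rfl fun τ hτ => ?_
    rw [(Finset.mem_powersetCard.1 hτ).2, Nat.add_sub_cancel]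
  · intro τ hτ
    obtain ⟨-, h1, h2⟩ := mem_lowFaces.1 hτ
    simp only [Finset.mem_Icc]
    omega

end Coins

/-! ### Expected numbers of crowded faces and of hollow sets. -/

section Expectation

variable {d n k : ℕ} {f : EuclideanSpace ℝ (Fin d) → ℝ} {p : ℕ → unitInterval} {r ε : ℝ}

theorem measureReal_biUnion_le_card_mul {Ω α : Type*} [MeasurableSpace Ω] (P : Measure Ω)
    [IsFiniteMeasure P] (s : Finset α) (A : α → Set Ω) {C : ℝ} (h : ∀ a ∈ s, P.real (A a) ≤ C) :
    P.real (⋃ a ∈ s, A a) ≤ s.card * C := by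
  refine (measureReal_biUnion_finset_le s A).trans ?_
  rw [← nsmul_eq_mul]
  exact Finset.sum_le_card_nsmul _ _ _ h

/-- Each piece of the union is a rectangle in points and coins, so its probability factors. The
coins of the edges towards `u` and `v` are discarded; only those of `σ` are needed. -/
theorem crowdedFaces_subset {σ : Finset (Fin n)} {a : Fin n} (ha : a ∈ σ) :
    {ω : Sample d n | σ ∈ crowdedFaces (softRips r ω) k} ⊆
      ⋃ u ∈ σᶜ, ⋃ v ∈ (insert u σ)ᶜ, ⋃ b ∈ σ, ⋃ c ∈ insert u σ,
        {x | (∀ i ∈ σ.erase a, dist (x a) (x i) ≤ r) ∧ dist (x b) (x u) ≤ r ∧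
          dist (x c) (x v) ≤ r} ×ˢ {ξ | ∀ τ ∈ lowFaces σ k, ξ τ = true} := by
  intro ω hω
  replace hω : σ ∈ crowdedFaces (softRips r ω) k := hω
  obtain ⟨hσ, -, u, hu, v, hv, ⟨b, hb, hbu⟩, c, hcu, hcv⟩ := mem_crowdedFaces.1 hω
  simp only [Set.mem_iUnion]
  refine ⟨u, Finset.mem_compl.2 hu, v, Finset.mem_compl.2 hv, b, hb, c, hcu, ⟨?_, ?_, ?_⟩, ?_⟩
  · intro i hi
    rw [Finset.mem_erase] at hi
    exact (mem_softRips_iff.1 hσ).2.1 a ha i hi.2 (Ne.symm hi.1)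
  · exact dist_le_of_pair_mem_softRips (ne_of_mem_of_not_mem hb hu) hbu
  · exact dist_le_of_pair_mem_softRips (ne_of_mem_of_not_mem hcu hv) hcv
  · intro τ hτ
    have := mem_lowFaces.1 hτ
    exact (mem_softRips_iff.1 hσ).2.2 τ this.1 this.2.1

variable [IsProbabilityMeasure (volume.withDensity fun x => ENNReal.ofReal (f x))]

instance : IsProbabilityMeasure (sampleLaw f p n) := by
  unfold sampleLaw; infer_instance

/-- Union bound: at most `n` choices each for `u` and `v`, then `k + 1` for `b` and `k + 2` for `c`.
The `k + 2` factors `ε` come from the `k` leaves of the star and from `u` and `v`. -/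
theorem real_crowdedFaces_le (hε0 : 0 ≤ ε)
    (hε : ∀ x, (volume.withDensity fun x => ENNReal.ofReal (f x)) (Metric.closedBall x r) ≤
      ENNReal.ofReal ε) (σ : Finset (Fin n)) (hc : σ.card = k + 1) :
    (sampleLaw f p n).real {ω | σ ∈ crowdedFaces (softRips r ω) k} ≤
      n ^ 2 * ((k + 1) * (k + 2)) * (ε ^ (k + 2) *
        ∏ i ∈ Finset.Icc 1 k, (p i : ℝ) ^ (k + 1).choose (i + 1)) := by
  obtain ⟨a, ha⟩ : σ.Nonempty := Finset.card_pos.1 (by omega)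
  set Q := ∏ i ∈ Finset.Icc 1 k, (p i : ℝ) ^ (k + 1).choose (i + 1) with hQ
  have hQ0 : 0 ≤ Q := Finset.prod_nonneg fun i _ => pow_nonneg (p i).2.1 _
  have hcard : ∀ T : Finset (Fin n), T.card ≤ n := fun T =>
    T.card_le_univ.trans_eq (Fintype.card_fin n)
  have hC : (0 : ℝ) ≤ ε ^ (k + 2) * Q := by positivity
  refine (measureReal_mono (crowdedFaces_subset ha) (measure_ne_top _ _)).trans ?_
  have h4 : ∀ u ∈ σᶜ, ∀ v ∈ (insert u σ)ᶜ, ∀ b ∈ σ, ∀ c ∈ insert u σ, (sampleLaw f p n).real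
      ({x | (∀ i ∈ σ.erase a, dist (x a) (x i) ≤ r) ∧ dist (x b) (x u) ≤ r ∧
          dist (x c) (x v) ≤ r} ×ˢ {ξ | ∀ τ ∈ lowFaces σ k, ξ τ = true}) ≤ ε ^ (k + 2) * Q := by
    intro u hu v hv b hb c hcu
    rw [sampleLaw, measureReal_prod_prod, 
      pi_bernoulli_real (fun τ : Finset (Fin n) => p (τ.card - 1)) _ fun _ => true]
    simp only [if_true]
    rw [prod_lowFaces σ k fun i => (p i : ℝ), hc]
    refine mul_le_mul_of_nonneg_right ?_ hQ0
    refine ENNReal.toReal_le_of_le_ofReal (by positivity) ?_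
    have hins := Finset.insert_erase ha
    have := pi_star_extend_le (volume.withDensity fun x => ENNReal.ofReal (f x)) hε (a := a)
      (b := b) (c := c) (u := u) (v := v) (T := σ.erase a) (Finset.notMem_erase _ _)
      (by rwa [hins]) (by rwa [hins, ← Finset.mem_compl]) (by rwa [hins])
      (by rwa [hins, ← Finset.mem_compl])
    refine this.trans_eq ?_
    rw [Finset.card_erase_of_mem ha, hc, Nat.add_sub_cancel, ENNReal.ofReal_pow hε0]
  have h1 : ∀ u ∈ σᶜ, (sampleLaw f p n).real (⋃ v ∈ (insert u σ)ᶜ, ⋃ b ∈ σ, ⋃ c ∈ insert u σ,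
      {x | (∀ i ∈ σ.erase a, dist (x a) (x i) ≤ r) ∧ dist (x b) (x u) ≤ r ∧
        dist (x c) (x v) ≤ r} ×ˢ {ξ | ∀ τ ∈ lowFaces σ k, ξ τ = true}) ≤
      n * ((k + 1) * ((k + 2) * (ε ^ (k + 2) * Q))) := by
    intro u hu
    refine (measureReal_biUnion_le_card_mul _ _ _ fun v hv =>
      measureReal_biUnion_le_card_mul _ _ _ fun b hb =>
      measureReal_biUnion_le_card_mul _ _ _ fun c hcu => h4 u hu v hv b hb c hcu).trans ?_
    rw [Finset.card_insert_of_notMem (Finset.mem_compl.1 hu), hc]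
    push_cast
    rw [show (k : ℝ) + 1 + 1 = k + 2 by ring]
    gcongr
    exact hcard _
  refine (measureReal_biUnion_le_card_mul _ _ _ h1).trans ?_
  calc _ ≤ n * (n * ((k + 1) * ((k + 2) * (ε ^ (k + 2) * Q)))) := by
        gcongr
        exact hcard _
    _ = _ := by ring

theorem integral_crowdedFaces_le (hε0 : 0 ≤ ε)
    (hε : ∀ x, (volume.withDensity fun x => ENNReal.ofReal (f x)) (Metric.closedBall x r) ≤
      ENNReal.ofReal ε) :
    ∫ ω, ((crowdedFaces (softRips r ω) k).card : ℝ) ∂(sampleLaw f p n) ≤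
      ((k + 1) * (k + 2)) * (n ^ (k + 3) * ε ^ (k + 2) *
        ∏ i ∈ Finset.Icc 1 k, (p i : ℝ) ^ (k + 1).choose (i + 1)) := by
  set Q := ∏ i ∈ Finset.Icc 1 k, (p i : ℝ) ^ (k + 1).choose (i + 1) with hQ
  have hQ0 : 0 ≤ Q := Finset.prod_nonneg fun i _ => pow_nonneg (p i).2.1 _
  rw [integral_card_softRips r _ fun K => crowdedFaces K k,
    ← Finset.sum_subset (Finset.subset_univ (Finset.univ.powersetCard (k + 1)))]
  · refine (Finset.sum_le_card_nsmul _ _ _ fun σ hσ =>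
      real_crowdedFaces_le hε0 hε σ (Finset.mem_powersetCard.1 hσ).2).trans ?_
    rw [Finset.card_powersetCard, Finset.card_univ, Fintype.card_fin, nsmul_eq_mul]
    have : (n.choose (k + 1) : ℝ) ≤ n ^ (k + 1) := by exact_mod_cast Nat.choose_le_pow n (k + 1)
    calc _ ≤ (n : ℝ) ^ (k + 1) * (n ^ 2 * ((k + 1) * (k + 2)) * (ε ^ (k + 2) * Q)) := by gcongr
      _ = _ := by ring
  · intro σ _ hσ
    have : {ω : Sample d n | σ ∈ crowdedFaces (softRips r ω) k} = ∅ := by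
      refine Set.eq_empty_of_forall_notMem fun ω hω => hσ ?_
      exact Finset.mem_powersetCard.2 ⟨Finset.subset_univ _, (mem_crowdedFaces.1 hω).2.1⟩
    rw [this, measureReal_empty]

/-- The pattern `!decide (τ = S)` asks for heads on the proper faces and tails on `S`. Isolation is
imposed through distances alone, so that the event is again a rectangle. -/
theorem subset_hollowSets {S : Finset (Fin n)} (hc : S.card = k + 2) :
    (clique S r ∩ {x | ∀ i ∈ S, ∀ j ∉ S, r < dist (x i) (x j)}) ×ˢ
      {ξ | ∀ τ ∈ insert S (lowFaces S k), ξ τ = !decide (τ = S)} ⊆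
    {ω : Sample d n | S ∈ hollowSets (softRips r ω) k} := by
  rintro ω ⟨⟨hx, hi⟩, hξ⟩
  refine mem_hollowSets.2 ⟨hc, fun i hiS j hj h => ?_, fun τ hτ hne => ?_, fun h => ?_⟩
  · exact (dist_le_of_pair_mem_softRips (ne_of_mem_of_not_mem hiS hj) h).not_gt (hi i hiS j hj)
  · refine mem_softRips_iff.2 ⟨hne, fun i hi j hj _ => hx i (hτ.1 hi) j (hτ.1 hj),
      fun υ hυ h2 => ?_⟩
    have hlt := (Finset.card_le_card hυ).trans_lt (Finset.card_lt_card hτ)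
    have hne : υ ≠ S := by rintro rfl; omega
    rw [hξ υ (Finset.mem_insert_of_mem (mem_lowFaces.2 ⟨hυ.trans hτ.1, h2, by omega⟩))]
    simp [hne]
  · have h1 := (mem_softRips_iff.1 h).2.2 S subset_rfl (by omega)
    rw [hξ S (Finset.mem_insert_self _ _)] at h1
    simp at h1

/-- The assumption `hsmall` bounds the loss from demanding isolation by half the clique probability,
whence `a / 2`. -/
theorem le_real_hollowSets (hε0 : 0 ≤ ε)
    (hε : ∀ x, (volume.withDensity fun x => ENNReal.ofReal (f x)) (Metric.closedBall x r) ≤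
      ENNReal.ofReal ε) (hsmall : (k + 2) * n * ε ≤ 1 / 2) {a : ℝ} {S : Finset (Fin n)}
    (hc : S.card = k + 2)
    (ha : a ≤ (Measure.pi fun _ : Fin n =>
      volume.withDensity fun x => ENNReal.ofReal (f x)).real (clique S r)) :
    a / 2 * ((1 - p (k + 1)) * ∏ i ∈ Finset.Icc 1 k, (p i : ℝ) ^ (k + 2).choose (i + 1)) ≤
      (sampleLaw f p n).real {ω | S ∈ hollowSets (softRips r ω) k} := by
  refine le_trans ?_ (measureReal_mono (subset_hollowSets hc) (measure_ne_top _ _))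
  have hS : S ∉ lowFaces S k := fun h => by have := mem_lowFaces.1 h; omega
  have hcoin : ∏ τ ∈ insert S (lowFaces S k),
      (if (!decide (τ = S)) = true then (p (τ.card - 1) : ℝ) else 1 - p (τ.card - 1)) =
      (1 - p (k + 1)) * ∏ i ∈ Finset.Icc 1 k, (p i : ℝ) ^ (k + 2).choose (i + 1) := by
    rw [Finset.prod_insert hS, ← hc, ← prod_lowFaces S k fun i => (p i : ℝ)]
    congr 1
    · simp [hc]
    · refine Finset.prod_congr rfl fun τ hτ => ?_
      have : τ ≠ S := ne_of_mem_of_not_mem hτ hS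
      simp [this]
  rw [sampleLaw, measureReal_prod_prod, pi_bernoulli_real (fun τ : Finset (Fin n) => p (τ.card - 1)) _
    fun τ => !decide (τ = S), hcoin]
  refine mul_le_mul_of_nonneg_right ?_ (mul_nonneg (sub_nonneg.2 (p _).2.2)
    (Finset.prod_nonneg fun i _ => pow_nonneg (p i).2.1 _))
  have h := le_pi_isolated_clique (volume.withDensity fun x => ENNReal.ofReal (f x)) hε S
  set P := Measure.pi fun _ : Fin n => volume.withDensity fun x => ENNReal.ofReal (f x)
  have h' := ENNReal.toReal_mono (by finiteness) h
  rw [ENNReal.toReal_add (by finiteness) (by finiteness), ENNReal.toReal_mul, ENNReal.toReal_mul,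
    ENNReal.toReal_ofReal hε0, ENNReal.toReal_natCast, hc, Fintype.card_fin] at h'
  change P.real (clique S r) ≤ P.real _ + _ * (_ * P.real (clique S r)) at h'
  push_cast at h'
  have : (k + 2) * n * ε * P.real (clique S r) ≤ 1 / 2 * P.real (clique S r) := by gcongr
  linarith

theorem le_integral_hollowSets (hε0 : 0 ≤ ε)
    (hε : ∀ x, (volume.withDensity fun x => ENNReal.ofReal (f x)) (Metric.closedBall x r) ≤
      ENNReal.ofReal ε) (hsmall : (k + 2) * n * ε ≤ 1 / 2) {a : ℝ}
    (ha : ∀ S : Finset (Fin n), S.card = k + 2 → a ≤ (Measure.pi fun _ : Fin n =>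
      volume.withDensity fun x => ENNReal.ofReal (f x)).real (clique S r)) :
    n.choose (k + 2) * (a / 2 *
      ((1 - p (k + 1)) * ∏ i ∈ Finset.Icc 1 k, (p i : ℝ) ^ (k + 2).choose (i + 1))) ≤
      ∫ ω, ((hollowSets (softRips r ω) k).card : ℝ) ∂(sampleLaw f p n) := by
  rw [integral_card_softRips r _ fun K => hollowSets K k]
  refine le_trans ?_ (Finset.sum_le_sum_of_subset_of_nonneg
    (Finset.subset_univ (Finset.univ.powersetCard (k + 2))) fun _ _ _ => measureReal_nonneg)
  refine le_trans (le_of_eq ?_) (Finset.card_nsmul_le_sum _ _ _ fun S hS =>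
    le_real_hollowSets hε0 hε hsmall (Finset.mem_powersetCard.1 hS).2
      (ha S (Finset.mem_powersetCard.1 hS).2))
  rw [Finset.card_powersetCard, Finset.card_univ, Fintype.card_fin, nsmul_eq_mul]

end Expectation

/-! ### Ball probabilities under a bounded density. -/

section Density

variable {d : ℕ} {f : EuclideanSpace ℝ (Fin d) → ℝ}

theorem isProbabilityMeasure_withDensity (hf_nonneg : ∀ x, 0 ≤ f x) (hf_int : ∫ x, f x = 1) :
    IsProbabilityMeasure (volume.withDensity fun x => ENNReal.ofReal (f x)) := by
  have hint : Integrable f := by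
    by_contra h
    rw [integral_undef h] at hf_int
    exact zero_ne_one hf_int
  refine ⟨?_⟩
  rw [withDensity_apply _ MeasurableSet.univ, Measure.restrict_univ,
    ← ofReal_integral_eq_lintegral_ofReal hint (ae_of_all _ hf_nonneg), hf_int, ENNReal.ofReal_one]

theorem withDensity_closedBall_le {M : ℝ} (hM : 0 ≤ M) (hf : ∀ x, f x ≤ M) {r : ℝ} (hr : 0 ≤ r)
    (x : EuclideanSpace ℝ (Fin d)) :
    (volume.withDensity fun x => ENNReal.ofReal (f x)) (Metric.closedBall x r) ≤
      ENNReal.ofReal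
        (M * volume.real (Metric.ball (0 : EuclideanSpace ℝ (Fin d)) 1) * r ^ d) := by
  rw [withDensity_apply _ Metric.isClosed_closedBall.measurableSet]
  calc ∫⁻ y in Metric.closedBall x r, ENNReal.ofReal (f y)
      ≤ ∫⁻ _ in Metric.closedBall x r, ENNReal.ofReal M :=
        lintegral_mono fun y => ENNReal.ofReal_le_ofReal (hf y)
    _ = ENNReal.ofReal M * volume (Metric.closedBall x r) := setLIntegral_const _ _
    _ = _ := by
      rw [Measure.addHaar_closedBall _ _ hr, finrank_euclideanSpace, Fintype.card_fin,
        mul_right_comm, ENNReal.ofReal_mul (by positivity), ENNReal.ofReal_mul hM, mul_assoc,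
        ofReal_measureReal measure_ball_lt_top.ne]

end Density

/-! ### Comparison of the two expectations. -/

theorem pow_le_mul_choose {n m : ℕ} (h : 2 * m ≤ n) :
    (n : ℝ) ^ m ≤ 2 ^ m * m.factorial * n.choose m := by
  have h1 : ((n + 1 - m : ℕ) ^ m : ℝ) / m.factorial ≤ n.choose m := Nat.pow_le_choose m n
  rw [div_le_iff₀ (by positivity)] at h1
  have h2 : (n : ℝ) ≤ 2 * (n + 1 - m : ℕ) := by
    have : n ≤ 2 * (n + 1 - m) := by omega
    exact_mod_cast this
  calc (n : ℝ) ^ m ≤ (2 * (n + 1 - m : ℕ)) ^ m := by gcongr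
    _ = 2 ^ m * (n + 1 - m : ℕ) ^ m := mul_pow _ _ _
    _ ≤ 2 ^ m * (n.choose m * m.factorial) := by gcongr
    _ = _ := by ring

/-- Pascal's rule in the exponent. The first factor is the one in the hypothesis of the theorem; the
second also appears in the bound for crowded faces and cancels. -/
theorem prod_pow_choose_succ (k : ℕ) (g : ℕ → ℝ) :
    ∏ i ∈ Finset.Icc 1 k, g i ^ (k + 2).choose (i + 1) =
      (∏ i ∈ Finset.Icc 1 k, g i ^ (k + 1).choose i) *
        ∏ i ∈ Finset.Icc 1 k, g i ^ (k + 1).choose (i + 1) := by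
  rw [← Finset.prod_mul_distrib]
  refine Finset.prod_congr rfl fun i _ => ?_
  rw [← pow_add, Nat.choose_succ_succ]

theorem integral_betti_bounds {d n k : ℕ} (hk : 1 ≤ k) (F : Type*) [Field F] (r : ℝ)
    (P : Measure (Sample d n)) [IsFiniteMeasure P] :
    ∫ ω, ((hollowSets (softRips r ω) k).card : ℝ) ∂P ≤
        ∫ ω, (betti F (softRips r ω) k : ℝ) ∂P ∧
      ∫ ω, (betti F (softRips r ω) k : ℝ) ∂P ≤
        ∫ ω, ((hollowSets (softRips r ω) k).card : ℝ) ∂P +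
          ∫ ω, ((crowdedFaces (softRips r ω) k).card : ℝ) ∂P := by
  have hT := integrable_comp_softRips r P fun K => ((hollowSets K k).card : ℝ)
  have hL := integrable_comp_softRips r P fun K => ((crowdedFaces K k).card : ℝ)
  have hB := integrable_comp_softRips r P fun K => (betti F K k : ℝ)
  refine ⟨integral_mono hT hB fun ω => ?_, ?_⟩
  · exact Nat.cast_le.2 (card_hollowSets_le_betti hk)
  · rw [← integral_add hT hL]
    refine integral_mono hB (hT.add hL) fun ω => ?_
    have := betti_le (F := F) (K := softRips r ω) hk
    simp only
    exact_mod_cast this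

/-- Crowded faces are negligible compared with isolated hollow simplices. -/
theorem exists_integral_crowdedFaces_le {d k : ℕ} (hd : 1 ≤ d) (hk : 1 ≤ k)
    {f : EuclideanSpace ℝ (Fin d) → ℝ} (hf_nonneg : ∀ x, 0 ≤ f x) (hf_int : ∫ x, f x = 1)
    (hf_bdd : ∃ M : ℝ, ∀ x, f x ≤ M) :
    ∃ C δ : ℝ, 0 < δ ∧ ∀ (n : ℕ) (r : ℝ) (p : ℕ → unitInterval), 2 * (k + 2) ≤ n → 0 < r →
      (1 - (p (k + 1) : ℝ)) * ∏ i ∈ Finset.Icc 1 k, (p i : ℝ) ^ (k + 1).choose i ≠ 0 →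
      n * r ^ d ≤ δ →
      0 < ∫ ω, ((hollowSets (softRips r ω) k).card : ℝ) ∂(sampleLaw f p n) ∧
      ∫ ω, ((crowdedFaces (softRips r ω) k).card : ℝ) ∂(sampleLaw f p n) ≤
        C * (n * r ^ d / ((1 - (p (k + 1) : ℝ)) *
          ∏ i ∈ Finset.Icc 1 k, (p i : ℝ) ^ (k + 1).choose i)) *
        ∫ ω, ((hollowSets (softRips r ω) k).card : ℝ) ∂(sampleLaw f p n) := by
  obtain ⟨M₀, hM₀⟩ := hf_bdd
  set M := max M₀ 1
  have hM : ∀ x, f x ≤ M := fun x => (hM₀ x).trans (le_max_left _ _)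
  have hM0 : 0 < M := zero_lt_one.trans_le (le_max_right _ _)
  have hprob := isProbabilityMeasure_withDensity hf_nonneg hf_int
  set B := M * volume.real (Metric.ball (0 : EuclideanSpace ℝ (Fin d)) 1) with hB
  have hB0 : 0 < B := mul_pos hM0 (ENNReal.toReal_pos (Metric.measure_ball_pos _ _ one_pos).ne'
    measure_ball_lt_top.ne)
  obtain ⟨c, hc, hclique⟩ := exists_le_pi_clique
    (volume.withDensity fun x => ENNReal.ofReal (f x)) (m := k + 1) (by omega)
  set A : ℝ := 2 ^ (k + 2) * (k + 2).factorial with hA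
  have hA0 : 0 < A := by positivity
  -- The first constant is the ratio of the constants in the upper and lower bounds. In `δ`, the
  -- entry `1` forces `r ≤ 1` and the other entry gives `hsmall`.
  refine ⟨(k + 1) * (k + 2) * B ^ (k + 2) * (2 * A / c), min 1 (1 / (2 * (k + 2) * B)),
    by positivity, fun n r p hn hr hp hδ => ?_⟩
  set y := r ^ d with hy
  have hy0 : 0 < y := by positivity
  have hn0 : (0 : ℝ) < n := by exact_mod_cast (by omega : 0 < n)
  have hr1 : r ≤ 1 := by
    rw [← pow_le_one_iff_of_nonneg hr.le (by omega : d ≠ 0)]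
    have h1 : (1 : ℝ) ≤ n := by exact_mod_cast (by omega : 1 ≤ n)
    calc y ≤ n * y := le_mul_of_one_le_left hy0.le h1
      _ ≤ 1 := hδ.trans (min_le_left _ _)
  have hε : ∀ x, (volume.withDensity fun x => ENNReal.ofReal (f x)) (Metric.closedBall x r) ≤
      ENNReal.ofReal (B * y) := withDensity_closedBall_le hM0.le hM hr.le
  have hε0 : 0 ≤ B * y := by positivity
  have hsmall : (k + 2) * n * (B * y) ≤ 1 / 2 := by
    have := hδ.trans (min_le_right _ _)
    rw [le_div_iff₀ (by positivity)] at this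
    linarith
  obtain ⟨hs, hD⟩ := mul_ne_zero_iff.1 hp
  set s := 1 - (p (k + 1) : ℝ) with hsdef
  set D := ∏ i ∈ Finset.Icc 1 k, (p i : ℝ) ^ (k + 1).choose i with hDdef
  have hs0 : 0 < s := lt_of_le_of_ne (sub_nonneg.2 (p _).2.2) hs.symm
  have hp0 : ∀ i ∈ Finset.Icc 1 k, 0 < (p i : ℝ) := by
    intro i hi
    -- The exponent `(k + 1).choose i` is positive for `i ≤ k`, so a nonzero factor forces `p i ≠
    -- 0`; this makes `Q` positive as well.
    have := Finset.prod_ne_zero_iff.1 hD i hi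
    rw [Finset.mem_Icc] at hi
    refine lt_of_le_of_ne (p i).2.1 (Ne.symm fun h0 => this ?_)
    rw [h0, zero_pow (Nat.choose_pos (by omega)).ne']
  have hD0 : 0 < D := Finset.prod_pos fun i hi => pow_pos (hp0 i hi) _
  set Q := ∏ i ∈ Finset.Icc 1 k, (p i : ℝ) ^ (k + 1).choose (i + 1) with hQ
  have hQ0 : 0 < Q := Finset.prod_pos fun i hi => pow_pos (hp0 i hi) _
  set T := ∫ ω, ((hollowSets (softRips r ω) k).card : ℝ) ∂(sampleLaw f p n)
  have hT : (n : ℝ) ^ (k + 2) / A * (c * y ^ (k + 1) / 2 * (s * (D * Q))) ≤ T := by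
    have h := le_integral_hollowSets (p := p) hε0 hε hsmall (a := c * y ^ (k + 1))
      fun S hS => hclique n S hS r hr hr1
    rw [prod_pow_choose_succ k fun i => (p i : ℝ)] at h
    refine le_trans ?_ h
    refine mul_le_mul_of_nonneg_right ?_ (by positivity)
    rw [div_le_iff₀ hA0, mul_comm]
    exact pow_le_mul_choose hn
  refine ⟨lt_of_lt_of_le (by positivity) hT, ?_⟩
  refine (integral_crowdedFaces_le hε0 hε).trans ?_
  calc _ = (k + 1) * (k + 2) * B ^ (k + 2) * (2 * A / c) * (n * y / (s * D)) *
        ((n : ℝ) ^ (k + 2) / A * (c * y ^ (k + 1) / 2 * (s * (D * Q)))) := by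
        rw [← hQ]
        field_simp
        ring
    _ ≤ _ := by gcongr

end SoftRips

end

/-! ### The squeeze. -/

theorem mainTheorem3 (d k : ℕ) (hd : 1 ≤ d) (hk : 1 ≤ k) (F : Type*) [Field F]
    (f : EuclideanSpace ℝ (Fin d) → ℝ) (hf_meas : Measurable f) (hf_nonneg : ∀ x, 0 ≤ f x)
    (hf_int : ∫ x, f x = 1) (hf_bdd : ∃ M : ℝ, ∀ x, f x ≤ M)
    (r : ℕ → ℝ) (hr : ∀ n, 0 < r n)
    (p : ℕ → ℕ → unitInterval)
    (hp : ∀ᶠ n in atTop, (1 - (p n (k + 1) : ℝ)) *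
      ∏ i ∈ Finset.Icc 1 k, (p n i : ℝ) ^ (k + 1).choose i ≠ 0)
    (hlim : Tendsto (fun n : ℕ => n * r n ^ d / ((1 - (p n (k + 1) : ℝ)) *
      ∏ i ∈ Finset.Icc 1 k, (p n i : ℝ) ^ (k + 1).choose i)) atTop (𝓝 0)) :
    Tendsto (fun n : ℕ =>
      (∫ ω, (SoftRips.betti F (SoftRips.softRips (r n) ω) k : ℝ) ∂(SoftRips.sampleLaw f (p n) n)) /
        (∫ ω, (SoftRips.boundaryComponents (SoftRips.softRips (r n) ω) k : ℝ)
          ∂(SoftRips.sampleLaw f (p n) n)))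
      atTop (𝓝 1) := by
  have hprob := SoftRips.isProbabilityMeasure_withDensity hf_nonneg hf_int
  obtain ⟨C, δ, hδ, hmain⟩ :=
    SoftRips.exists_integral_crowdedFaces_le hd hk hf_nonneg hf_int hf_bdd
  have hT : ∀ n, ∫ ω, (SoftRips.boundaryComponents (SoftRips.softRips (r n) ω) k : ℝ)
      ∂(SoftRips.sampleLaw f (p n) n) =
      ∫ ω, ((SoftRips.hollowSets (SoftRips.softRips (r n) ω) k).card : ℝ)
        ∂(SoftRips.sampleLaw f (p n) n) := fun n =>
    integral_congr_ae (ae_of_all _ fun ω =>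
      congrArg (Nat.cast : ℕ → ℝ) (SoftRips.boundaryComponents_eq hk))
  simp only [hT]
  have hbound : ∀ᶠ n : ℕ in atTop,
      0 < ∫ ω, ((SoftRips.hollowSets (SoftRips.softRips (r n) ω) k).card : ℝ)
        ∂(SoftRips.sampleLaw f (p n) n) ∧
      ∫ ω, ((SoftRips.crowdedFaces (SoftRips.softRips (r n) ω) k).card : ℝ)
        ∂(SoftRips.sampleLaw f (p n) n) ≤
        C * (n * r n ^ d / ((1 - (p n (k + 1) : ℝ)) *
          ∏ i ∈ Finset.Icc 1 k, (p n i : ℝ) ^ (k + 1).choose i)) *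
        ∫ ω, ((SoftRips.hollowSets (SoftRips.softRips (r n) ω) k).card : ℝ)
          ∂(SoftRips.sampleLaw f (p n) n) := by
    filter_upwards [hp, hlim.eventually_le_const hδ, eventually_ge_atTop (2 * (k + 2))]
      with n hn hle hge
    refine hmain n (r n) (p n) hge (hr n) hn (le_trans ?_ hle)
    have hs : 0 ≤ 1 - (p n (k + 1) : ℝ) := sub_nonneg.2 (p n _).2.2
    have hD : 0 ≤ ∏ i ∈ Finset.Icc 1 k, (p n i : ℝ) ^ (k + 1).choose i :=
      Finset.prod_nonneg fun i _ => pow_nonneg (p n i).2.1 _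
    -- The denominator is at most `1`, so `n * r n ^ d` is bounded by the quotient and is eventually
    -- below `δ`.
    refine le_div_self (by have := hr n; positivity)
      (lt_of_le_of_ne (mul_nonneg hs hD) hn.symm) ?_
    exact mul_le_one₀ (sub_le_self _ (p n _).2.1) hD
      (Finset.prod_le_one (fun i _ => pow_nonneg (p n i).2.1 _)
        fun i _ => pow_le_one₀ (p n i).2.1 (p n i).2.2)
  have hupper : Tendsto (fun n : ℕ => 1 + C * (n * r n ^ d / ((1 - (p n (k + 1) : ℝ)) *
      ∏ i ∈ Finset.Icc 1 k, (p n i : ℝ) ^ (k + 1).choose i))) atTop (𝓝 1) := by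
    simpa using (hlim.const_mul C).const_add 1
  refine tendsto_of_tendsto_of_tendsto_of_le_of_le' tendsto_const_nhds hupper ?_ ?_
  · filter_upwards [hbound] with n hn
    rw [one_le_div hn.1]
    exact (SoftRips.integral_betti_bounds hk F (r n) _).1
  · filter_upwards [hbound] with n hn
    rw [div_le_iff₀ hn.1, add_mul, one_mul]
    exact (SoftRips.integral_betti_bounds hk F (r n) _).2.trans (by gcongr; exact hn.2)
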